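/- Consider the linear system $x_{t+1}=Ax_t+Bu_t+Cw_t$, $x_t\in\mathbb R^q$, $u_t\in\mathbb R^p$, with known initial state $x_0=x$, where $(w_t)_{t\ge 0}$ are independent centred Gaussian vectors in $\mathbb R^s$ with covariance matrix $\Sigma_S$. Let $Q=J'J$ for a real matrix $J$ with $q$ columns, $R=R'$ positive definite, $0<\beta<1$, and let $O\ge 0$ be the cost of a measurement. A stationary strategy $\tilde\pi$ is a measurable map $x\mapsto(T(x),u_0(x),u_1(x),\dots)$ with $T(x)\in\{1,2,\dots\}$ and $u_k(x)\in\mathbb R^p$: whenever a state $x$ is measured, the controls $u_0(x),\dots,u_{T(x)-1}(x)$ are applied in the next $T(x)$ steps, and then the state is measured again. The initial state counts as measured free of charge at $\bar T_0=0$; let $\bar T_1<\bar T_2<\cdots$ be the times of the later measurements. The cost of $\tilde\pi$ and the value function are $$\tilde F(\tilde\pi;x)=\mathbb E\Big[\sum_{t=0}^\infty\beta^t(x_t'Qx_t+u_t'Ru_t)+\sum_{k=1}^\infty\beta^{\bar T_k}O\,\Big|\,x_0=x\Big],\qquad V(x)=\inf_{\tilde\pi}\tilde F(\tilde\pi;x).$$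 For $t\ge 0$ let $P_t$ be the covariance matrix of $x_t$ (that is, of the estimation error $x_t-\mathbb E[x_t]$) when $x_0$ is known, the controls are deterministic, and no measurement is made; it does not depend on $x_0$ or on the controls, and $P_0=0$, $P_{t+1}=AP_tA'+C\Sigma_SC'$. Suppose that $(A,B)$ is controllable and $(A,J)$ is observable. Then the following hold. (a) The discounted algebraic Riccati equation $$P=Q+\beta A'PA-A'PB\beta(R+\beta B'PB)^{-1}\beta B'PA$$ has a unique solution $P$ among the symmetric positive semidefinite matrices, and this $P$ is positive definite. (b) Put $\varphi=A'PB\beta(R+\beta B'PB)^{-1}\beta B'PA$. The fixed-point equation $$r=\inf_{T\in\{1,2,\dots\}}\Big\{\sum_{t=0}^{T-1}\beta^t\operatorname{Tr}(P_t\varphi)+\sum_{t=1}^{T}\beta^t\operatorname{Tr}(\Sigma_SC'PC)+\beta^T(r+O)\Big\}$$ has a unique solution $r\in\mathbb R$. (c) For every $x\in\mathbb R^q$, $V(x)$ is finite and $V(x)=x'Px+r$. (d) The optimal waiting time does not depend on $x$: for every $x$ and every $T\ge 1$, $T$ minimizes $$T\mapsto\inf_{u_0,\dots,u_{T-1}\in\mathbb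 R^p}\mathbb E\Big[\sum_{t=0}^{T-1}\beta^t(x_t'Qx_t+u_t'Ru_t)+\beta^TV(x_T)+\beta^TO\,\Big|\,x_0=x\Big]$$ over $\{1,2,\dots\}$ if and only if $T$ attains the infimum in (b). -/

import Mathlib

open MeasureTheory ProbabilityTheory Matrix
open scoped ENNReal

/-- The Kalman controllability matrix `[B, AB, …, A^(q-1)B]` has rank `q`. -/
def IsControllable {q p : ℕ} (A : Matrix (Fin q) (Fin q) ℝ) (B : Matrix (Fin q) (Fin p) ℝ) :
    Prop :=
  (Matrix.of fun (i : Fin q) (kj : Fin q × Fin p) => (A ^ (kj.1 : ℕ) * B) i kj.2).rank = q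

/-- The Kalman observability matrix with row blocks `J, JA, …, JA^(q-1)` has rank `q`. -/
def IsObservable {q m : ℕ} (A : Matrix (Fin q) (Fin q) ℝ) (J : Matrix (Fin m) (Fin q) ℝ) :
    Prop :=
  (Matrix.of fun (ki : Fin q × Fin m) (j : Fin q) => (J * A ^ (ki.1 : ℕ)) ki.2 j).rank = q

/-- Gaussian white noise: independent centred Gaussian vectors with covariance matrix `S`. -/
structure IsGaussianWhiteNoise {Ω : Type*} [MeasurableSpace Ω] {s : ℕ}
    (w : ℕ → Ω → Fin s → ℝ) (S : Matrix (Fin s) (Fin s) ℝ) (μ : Measure Ω) : Prop where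
  measurable : ∀ t, Measurable (w t)
  gaussian : ∀ t, HasGaussianLaw (w t) μ
  mean_zero : ∀ t i, ∫ ω, w t ω i ∂μ = 0
  second_moment : ∀ t i j, ∫ ω, w t ω i * w t ω j ∂μ = S i j
  indep : iIndepFun w μ

/-- The data of the control problem: dynamics `x_{t+1} = A x_t + B u_t + C w_t`, stage cost
`x'Qx + u'Ru`, discount factor `β` and cost `O` of one measurement. -/
structure LQGData (q p s : ℕ) where
  A : Matrix (Fin q) (Fin q) ℝ
  B : Matrix (Fin q) (Fin p) ℝ
  C : Matrix (Fin q) (Fin s) ℝ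
  Q : Matrix (Fin q) (Fin q) ℝ
  R : Matrix (Fin p) (Fin p) ℝ
  β : ℝ
  O : ℝ

/-- A stationary strategy `x ↦ (T, u₀, u₁, …)`: when the state `x` is measured, the next
measurement takes place `wait x ≥ 1` steps later, and until then the control applied `k` steps
after the measurement is `ctrl k x`. -/
structure Strategy (q p : ℕ) where
  wait : (Fin q → ℝ) → ℕ
  ctrl : ℕ → (Fin q → ℝ) → (Fin p → ℝ)
  one_le_wait : ∀ x, 1 ≤ wait x
  measurable_wait : Measurable wait
  measurable_ctrl : ∀ k, Measurable (ctrl k)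

namespace LQGData

variable {q p s : ℕ} (D : LQGData q p s)

/-- One step of the dynamics. -/
def step (x : Fin q → ℝ) (u : Fin p → ℝ) (w : Fin s → ℝ) : Fin q → ℝ :=
  D.A *ᵥ x + D.B *ᵥ u + D.C *ᵥ w

/-- The stage cost `x'Qx + u'Ru`. -/
def stageCost (x : Fin q → ℝ) (u : Fin p → ℝ) : ℝ :=
  x ⬝ᵥ (D.Q *ᵥ x) + u ⬝ᵥ (D.R *ᵥ u)

/-- The state at time `t` under the open-loop controls `u` and the noise path `w`,
started from `x`. -/
def openLoop (u : ℕ → Fin p → ℝ) (w : ℕ → Fin s → ℝ) (x : Fin q → ℝ) : ℕ → Fin q → ℝ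
  | 0 => x
  | t + 1 => D.step (openLoop u w x t) (u t) (w t)

/-- The closed loop under `π` along the noise path `w`. The three components at time `t` are the
state `x_t`, the most recently measured state, and the number of steps since that measurement.
The initial state counts as measured. -/
def closedLoop (π : Strategy q p) (w : ℕ → Fin s → ℝ) (x : Fin q → ℝ) :
    ℕ → (Fin q → ℝ) × (Fin q → ℝ) × ℕ
  | 0 => (x, x, 0)
  | t + 1 =>
    let c := closedLoop π w x t
    let y := D.step c.1 (π.ctrl c.2.2 c.2.1) (w t)
    if c.2.2 + 1 = π.wait c.2.1 then (y, y, 0) else (y, c.2.1, c.2.2 + 1)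

/-- The state `x_t` under the strategy `π`. -/
def state (π : Strategy q p) (w : ℕ → Fin s → ℝ) (x : Fin q → ℝ) (t : ℕ) : Fin q → ℝ :=
  (D.closedLoop π w x t).1

/-- The control `u_t` under the strategy `π`. -/
def control (π : Strategy q p) (w : ℕ → Fin s → ℝ) (x : Fin q → ℝ) (t : ℕ) : Fin p → ℝ :=
  π.ctrl (D.closedLoop π w x t).2.2 (D.closedLoop π w x t).2.1

/-- The time of the `k`-th measurement under `π` (the known initial state is number `0`). -/
def measTime (π : Strategy q p) (w : ℕ → Fin s → ℝ) (x : Fin q → ℝ) : ℕ → ℕ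
  | 0 => 0
  | k + 1 => measTime π w x k + π.wait (D.state π w x (measTime π w x k))

/-- The expected discounted cost of the strategy `π` from the initial state `x`. All terms are
nonnegative when `Q`, `R` are positive semidefinite and `β, O ≥ 0`, so the expectation is taken
in `[0, ∞]`. -/
noncomputable def cost {Ω : Type*} [MeasurableSpace Ω] (μ : Measure Ω) (w : ℕ → Ω → Fin s → ℝ)
    (π : Strategy q p) (x : Fin q → ℝ) : ℝ≥0∞ :=
  ∫⁻ ω,
    ((∑' t : ℕ, ENNReal.ofReal (D.β ^ t *
        D.stageCost (D.state π (fun j => w j ω) x t) (D.control π (fun j => w j ω) x t)))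
      + ∑' k : ℕ, ENNReal.ofReal (D.β ^ D.measTime π (fun j => w j ω) x (k + 1) * D.O)) ∂μ

/-- The value function: the infimum of the cost over all stationary strategies. -/
noncomputable def value {Ω : Type*} [MeasurableSpace Ω] (μ : Measure Ω) (w : ℕ → Ω → Fin s → ℝ)
    (x : Fin q → ℝ) : ℝ≥0∞ :=
  ⨅ π : Strategy q p, D.cost μ w π x

/-- The right-hand side of the dynamic programming equation with controlled lookahead for a fixed
waiting time `T`: the infimum over the controls `u₀, …, u_{T-1}` of
`E[∑_{t<T} β^t (x_t'Qx_t + u_t'Ru_t) + β^T V(x_T) + β^T O | x₀ = x]` with `V` the value function.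
Controls from time `T` on do not enter. -/
noncomputable def lookahead {Ω : Type*} [MeasurableSpace Ω] (μ : Measure Ω)
    (w : ℕ → Ω → Fin s → ℝ) (x : Fin q → ℝ) (T : ℕ) : ℝ≥0∞ :=
  ⨅ u : ℕ → Fin p → ℝ,
    ∫⁻ ω,
      ((∑ t ∈ Finset.range T, ENNReal.ofReal (D.β ^ t *
          D.stageCost (D.openLoop u (fun j => w j ω) x t) (u t)))
        + ENNReal.ofReal (D.β ^ T) * D.value μ w (D.openLoop u (fun j => w j ω) x T)
        + ENNReal.ofReal (D.β ^ T * D.O)) ∂μ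

/-- `T` is an optimal waiting time at the measured state `x`: it minimizes the right-hand side of
the dynamic programming equation over all waiting times `1, 2, …`. -/
def IsOptimalWait {Ω : Type*} [MeasurableSpace Ω] (μ : Measure Ω) (w : ℕ → Ω → Fin s → ℝ)
    (x : Fin q → ℝ) (T : ℕ) : Prop :=
  1 ≤ T ∧ ∀ T' : ℕ, 1 ≤ T' → D.lookahead μ w x T ≤ D.lookahead μ w x T'

/-- The discounted algebraic Riccati equation. -/
def Riccati (P : Matrix (Fin q) (Fin q) ℝ) : Prop :=
  P = D.Q + D.β • (D.Aᵀ * P * D.A)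
    - (D.Aᵀ * P * D.B * (D.β • (D.R + D.β • (D.Bᵀ * P * D.B))⁻¹)) * (D.β • (D.Bᵀ * P * D.A))

/-- The matrix `φ = A'PB β (R + β B'PB)⁻¹ β B'PA`. -/
noncomputable def phi (P : Matrix (Fin q) (Fin q) ℝ) : Matrix (Fin q) (Fin q) ℝ :=
  (D.Aᵀ * P * D.B * (D.β • (D.R + D.β • (D.Bᵀ * P * D.B))⁻¹)) * (D.β • (D.Bᵀ * P * D.A))

/-- The covariance matrix of the estimation error `t` steps after a measurement, when no further
measurement is made, for noise with covariance matrix `S`. -/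
def errCov (S : Matrix (Fin s) (Fin s) ℝ) : ℕ → Matrix (Fin q) (Fin q) ℝ
  | 0 => 0
  | t + 1 => D.A * errCov S t * D.Aᵀ + D.C * S * D.Cᵀ

/-- The bracket of the scalar fixed-point equation: the estimation-error terms, the noise terms,
and `β^T (r + O)`. -/
noncomputable def bracket (S : Matrix (Fin s) (Fin s) ℝ) (P : Matrix (Fin q) (Fin q) ℝ) (r : ℝ)
    (T : ℕ) : ℝ :=
  (∑ t ∈ Finset.range T, D.β ^ t * (D.errCov S t * D.phi P).trace)
    + (∑ t ∈ Finset.Icc 1 T, D.β ^ t * (S * D.Cᵀ * P * D.C).trace)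
    + D.β ^ T * (r + D.O)

/-- The scalar fixed-point equation: `r` is the infimum (in `ℝ`) over `T ≥ 1` of the bracket. -/
def FixedPoint (S : Matrix (Fin s) (Fin s) ℝ) (P : Matrix (Fin q) (Fin q) ℝ) (r : ℝ) : Prop :=
  IsGLB {c : ℝ | ∃ T : ℕ, 1 ≤ T ∧ c = D.bracket S P r T} r

end LQGData

/-! Completing the square (`complete_square`) turns one stage cost plus the discounted form of `P`
at the next state into the form of `ricc P` at the current state plus a nonnegative square, which
vanishes exactly under the linear gain. If `P` solves the Riccati equation, this telescopes along
noiseless trajectories (`noiseless_cost`).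

Between measurements the state is a noiseless trajectory plus an error that does not depend on the
controls. Expected quadratic costs therefore split into a noiseless part and traces against
`errCov`, and the Riccati equation rearranges these traces into the bracket (`trace_telescope`,
`lintegral_period`). Hence one period with terminal cost `x'Px + r` costs `x'Px`, plus squares, plus
a bracket that sees neither the state nor the controls. Feedback on the noiseless state removes the
squares, and only a state-independent choice of `T` remains.

For the upper bound on the value, a constant waiting time `T` with this feedback costs at most
`x'Px` plus an explicit offset. Since `β < 1`, the fixed-point equation says exactly that `r` is the
infimum of these offsets (`isGLB_bracket_iff`), which also gives existence and uniqueness of `r`.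

For the lower bound, the renewal equation of an arbitrary strategy is iterated (`le_cost`). The
terminal form has to disappear in the limit although the states may be unbounded. Observability
bounds it by later stage costs plus noise (`exists_sq_le_stageCost`), and these form the tail of a
convergent sum when the strategy has finite cost.

The Riccati solution is the limit of value iteration from `0`, which is monotone, and bounded
because controllability steers to the origin at finite cost. Uniqueness and definiteness come from
the same observability estimate. -/

/-! ### Quadratic forms of real matrices. -/

section QuadraticForms

variable {m n : ℕ}

/-- A quadratic form is bounded by a multiple of the Euclidean form. -/
theorem exists_quadForm_le (M : Matrix (Fin n) (Fin n) ℝ) :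
    ∃ c : ℝ, 0 ≤ c ∧ ∀ x : Fin n → ℝ, x ⬝ᵥ (M *ᵥ x) ≤ c * (x ⬝ᵥ x) := by
  refine ⟨∑ i, ∑ j, |M i j|, by positivity, fun x => ?_⟩
  have hx : ∀ i, x i ^ 2 ≤ x ⬝ᵥ x := fun i => by
    have := Finset.single_le_sum (f := fun i => x i * x i)
      (fun i _ => mul_self_nonneg (x i)) (Finset.mem_univ i)
    simpa [dotProduct, sq] using this
  have hl : x ⬝ᵥ (M *ᵥ x) = ∑ i, ∑ j, x i * (M i j * x j) := by
    simp only [dotProduct, mulVec, Finset.mul_sum]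
  simp only [hl, Finset.sum_mul]
  refine Finset.sum_le_sum fun i _ => Finset.sum_le_sum fun j _ => ?_
  have h1 : |x i * x j| ≤ x ⬝ᵥ x := by
    have := hx i
    have := hx j
    rw [abs_le]
    constructor <;> nlinarith [sq_nonneg (x i + x j), sq_nonneg (x i - x j)]
  calc x i * (M i j * x j) = M i j * (x i * x j) := by ring
    _ ≤ |M i j * (x i * x j)| := le_abs_self _
    _ = |M i j| * |x i * x j| := abs_mul _ _
    _ ≤ |M i j| * (x ⬝ᵥ x) := by gcongr

theorem dotProduct_mulVec_mulVec_self (M : Matrix (Fin m) (Fin n) ℝ) (x : Fin n → ℝ) :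
    (M *ᵥ x) ⬝ᵥ (M *ᵥ x) = x ⬝ᵥ ((Mᵀ * M) *ᵥ x) := by
  rw [← mulVec_mulVec, dotProduct_transpose_mulVec, dotProduct_comm]

theorem exists_mulVec_sq_le (M : Matrix (Fin m) (Fin n) ℝ) :
    ∃ c : ℝ, 0 ≤ c ∧ ∀ x : Fin n → ℝ, (M *ᵥ x) ⬝ᵥ (M *ᵥ x) ≤ c * (x ⬝ᵥ x) := by
  obtain ⟨c, hc, h⟩ := exists_quadForm_le (Mᵀ * M)
  exact ⟨c, hc, fun x => by rw [dotProduct_mulVec_mulVec_self]; exact h x⟩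

theorem posDef_real_iff {M : Matrix (Fin n) (Fin n) ℝ} :
    M.PosDef ↔ Mᵀ = M ∧ ∀ x : Fin n → ℝ, x ≠ 0 → 0 < x ⬝ᵥ (M *ᵥ x) := by
  rw [posDef_iff_dotProduct_mulVec]
  simp [IsHermitian, conjTranspose_eq_transpose_of_trivial]

theorem posSemidef_real_iff {M : Matrix (Fin n) (Fin n) ℝ} :
    M.PosSemidef ↔ Mᵀ = M ∧ ∀ x : Fin n → ℝ, 0 ≤ x ⬝ᵥ (M *ᵥ x) := by
  rw [posSemidef_iff_dotProduct_mulVec]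
  simp [IsHermitian, conjTranspose_eq_transpose_of_trivial]

/-- A positive definite form bounds the Euclidean form. -/
theorem exists_sq_le_of_posDef {M : Matrix (Fin n) (Fin n) ℝ} (hM : M.PosDef) :
    ∃ c : ℝ, 0 ≤ c ∧ ∀ x : Fin n → ℝ, x ⬝ᵥ x ≤ c * (x ⬝ᵥ (M *ᵥ x)) := by
  obtain ⟨N, hN⟩ : ∃ N : Matrix (Fin n) (Fin n) ℝ, M = Nᵀ * N := by
    open scoped MatrixOrder in
    obtain ⟨N, hN⟩ := CStarAlgebra.nonneg_iff_eq_star_mul_self.mp hM.posSemidef.nonneg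
    exact ⟨N, by rw [hN, star_eq_conjTranspose, conjTranspose_eq_transpose_of_trivial]⟩
  have hdet : IsUnit N.det := by
    have := (Matrix.isUnit_iff_isUnit_det M).mp hM.isUnit
    rw [hN, det_mul] at this
    exact isUnit_of_mul_isUnit_right this
  -- With `M = NᵀN`, the bound for `N⁻¹` is applied to `N x`, whose Euclidean square is the form of
  -- `M` at `x`.
  obtain ⟨c, hc, h⟩ := exists_mulVec_sq_le N⁻¹
  refine ⟨c, hc, fun x => ?_⟩
  have := h (N *ᵥ x)
  rwa [mulVec_mulVec, nonsing_inv_mul _ hdet, one_mulVec, dotProduct_mulVec_mulVec_self,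
    ← hN] at this

theorem dotProduct_self_add_le (x y : Fin n → ℝ) :
    (x + y) ⬝ᵥ (x + y) ≤ 2 * (x ⬝ᵥ x) + 2 * (y ⬝ᵥ y) := by
  simp only [dotProduct, Finset.mul_sum, ← Finset.sum_add_distrib]
  refine Finset.sum_le_sum fun i _ => ?_
  simp only [Pi.add_apply]
  nlinarith [sq_nonneg (x i - y i)]

theorem dotProduct_self_nonneg' (x : Fin n → ℝ) : 0 ≤ x ⬝ᵥ x :=
  Finset.sum_nonneg fun i _ => mul_self_nonneg (x i)

theorem quadForm_add {M : Matrix (Fin n) (Fin n) ℝ} (hM : Mᵀ = M) (x y : Fin n → ℝ) :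
    (x + y) ⬝ᵥ (M *ᵥ (x + y)) = x ⬝ᵥ (M *ᵥ x) + y ⬝ᵥ (M *ᵥ y) + 2 * (x ⬝ᵥ (M *ᵥ y)) := by
  have h : y ⬝ᵥ (M *ᵥ x) = x ⬝ᵥ (M *ᵥ y) := by
    conv_lhs => rw [← hM, dotProduct_transpose_mulVec]
  simp only [mulVec_add, add_dotProduct, dotProduct_add, h]
  ring

/-- A symmetric matrix is determined by its quadratic form. -/
theorem eq_of_quadForm_eq {M N : Matrix (Fin n) (Fin n) ℝ} (hM : Mᵀ = M) (hN : Nᵀ = N)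
    (h : ∀ x : Fin n → ℝ, x ⬝ᵥ (M *ᵥ x) = x ⬝ᵥ (N *ᵥ x)) : M = N := by
  ext i j
  have h1 := h (Pi.single i 1 + Pi.single j 1)
  rw [quadForm_add hM, quadForm_add hN, h, h] at h1
  simpa [single_one_dotProduct, mulVec_single_one] using h1

end QuadraticForms

/-! ### The Riccati operator as a one-step minimization. -/

namespace LQGData

variable {q p s m : ℕ} (D : LQGData q p s)

/-- The matrix `R + β B'PB`. -/
def gainDen (P : Matrix (Fin q) (Fin q) ℝ) : Matrix (Fin p) (Fin p) ℝ :=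
  D.R + D.β • (D.Bᵀ * P * D.B)

/-- The optimal feedback gain. -/
noncomputable def gain (P : Matrix (Fin q) (Fin q) ℝ) : Matrix (Fin p) (Fin q) ℝ :=
  D.β • ((D.gainDen P)⁻¹ * (D.Bᵀ * P * D.A))

/-- The Riccati operator. -/
noncomputable def ricc (P : Matrix (Fin q) (Fin q) ℝ) : Matrix (Fin q) (Fin q) ℝ :=
  D.Q + D.β • (D.Aᵀ * P * D.A) - D.phi P

variable {D}

theorem riccati_iff {P : Matrix (Fin q) (Fin q) ℝ} : D.Riccati P ↔ P = D.ricc P := Iff.rfl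

theorem gainDen_posDef (hR : D.R.PosDef) (hβ : 0 ≤ D.β) {P : Matrix (Fin q) (Fin q) ℝ}
    (hP : P.PosSemidef) : (D.gainDen P).PosDef := by
  refine hR.add_posSemidef (PosSemidef.smul ?_ hβ)
  simpa [conjTranspose_eq_transpose_of_trivial] using hP.conjTranspose_mul_mul_same D.B

theorem gainDen_mul_gain {P : Matrix (Fin q) (Fin q) ℝ} (hM : (D.gainDen P).PosDef) :
    D.gainDen P * D.gain P = D.β • (D.Bᵀ * P * D.A) := by
  rw [gain, Matrix.mul_smul, ← Matrix.mul_assoc,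
    mul_nonsing_inv _ ((isUnit_iff_isUnit_det _).mp hM.isUnit), Matrix.one_mul]

/-- The congruence form shows that `phi P` is positive semidefinite, and that its form is the square
`gainDen P` evaluated at the feedback control. -/
theorem phi_eq {P : Matrix (Fin q) (Fin q) ℝ} (hP : Pᵀ = P) (hM : (D.gainDen P).PosDef) :
    D.phi P = (D.gain P)ᵀ * D.gainDen P * D.gain P := by
  have hMt : (D.gainDen P)ᵀ = D.gainDen P := (posDef_real_iff.mp hM).1
  rw [Matrix.mul_assoc, gainDen_mul_gain hM, gain, transpose_smul, transpose_mul,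
    transpose_nonsing_inv, hMt, phi]
  simp only [transpose_mul, transpose_transpose, hP, gainDen, Matrix.mul_smul, Matrix.smul_mul,
    Matrix.mul_assoc]

theorem phi_posSemidef (hR : D.R.PosDef) (hβ : 0 ≤ D.β) {P : Matrix (Fin q) (Fin q) ℝ}
    (hP : P.PosSemidef) : (D.phi P).PosSemidef := by
  have hM := gainDen_posDef hR hβ hP
  rw [phi_eq (posSemidef_real_iff.mp hP).1 hM]
  simpa [conjTranspose_eq_transpose_of_trivial] using
    hM.posSemidef.conjTranspose_mul_mul_same (D.gain P)

theorem quadForm_phi {P : Matrix (Fin q) (Fin q) ℝ} (hP : Pᵀ = P) (hM : (D.gainDen P).PosDef)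
    (x : Fin q → ℝ) :
    x ⬝ᵥ (D.phi P *ᵥ x) = (D.gain P *ᵥ x) ⬝ᵥ (D.gainDen P *ᵥ (D.gain P *ᵥ x)) := by
  rw [phi_eq hP hM, Matrix.mul_assoc, ← mulVec_mulVec, dotProduct_transpose_mulVec,
    dotProduct_comm, mulVec_mulVec]

/-- Completing the square in the one-step optimization. -/
theorem complete_square {P : Matrix (Fin q) (Fin q) ℝ} (hP : Pᵀ = P)
    (hM : (D.gainDen P).PosDef) (x : Fin q → ℝ) (u : Fin p → ℝ) :
    D.stageCost x u + D.β * ((D.A *ᵥ x + D.B *ᵥ u) ⬝ᵥ (P *ᵥ (D.A *ᵥ x + D.B *ᵥ u)))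
      = x ⬝ᵥ (D.ricc P *ᵥ x)
        + (u + D.gain P *ᵥ x) ⬝ᵥ (D.gainDen P *ᵥ (u + D.gain P *ᵥ x)) := by
  -- The cross term fixes the gain: `gainDen P * gain P = β B'PA` is what makes it match.
  have h1 : u ⬝ᵥ (D.gainDen P *ᵥ (D.gain P *ᵥ x))
      = D.β * ((D.A *ᵥ x) ⬝ᵥ (P *ᵥ (D.B *ᵥ u))) := by
    rw [mulVec_mulVec, gainDen_mul_gain hM, smul_mulVec, dotProduct_smul, smul_eq_mul,
      Matrix.mul_assoc, ← mulVec_mulVec, dotProduct_transpose_mulVec, ← mulVec_mulVec,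
      dotProduct_comm, ← dotProduct_transpose_mulVec, hP]
  have h2 : u ⬝ᵥ (D.gainDen P *ᵥ u)
      = u ⬝ᵥ (D.R *ᵥ u) + D.β * ((D.B *ᵥ u) ⬝ᵥ (P *ᵥ (D.B *ᵥ u))) := by
    rw [gainDen, add_mulVec, dotProduct_add, smul_mulVec, dotProduct_smul, smul_eq_mul,
      Matrix.mul_assoc, ← mulVec_mulVec, dotProduct_transpose_mulVec, ← mulVec_mulVec,
      dotProduct_comm (P *ᵥ _)]
  have h3 : x ⬝ᵥ (D.ricc P *ᵥ x)
      = x ⬝ᵥ (D.Q *ᵥ x) + D.β * ((D.A *ᵥ x) ⬝ᵥ (P *ᵥ (D.A *ᵥ x))) - x ⬝ᵥ (D.phi P *ᵥ x) := by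
    rw [ricc, sub_mulVec, dotProduct_sub, add_mulVec, dotProduct_add, smul_mulVec,
      dotProduct_smul, smul_eq_mul, Matrix.mul_assoc, ← mulVec_mulVec,
      dotProduct_transpose_mulVec, ← mulVec_mulVec, dotProduct_comm (P *ᵥ _)]
  rw [quadForm_add hP, quadForm_add (posDef_real_iff.mp hM).1, h1, h2, h3, quadForm_phi hP hM,
    stageCost]
  ring

theorem ricc_le {P : Matrix (Fin q) (Fin q) ℝ} (hP : Pᵀ = P)
    (hM : (D.gainDen P).PosDef) (x : Fin q → ℝ) (u : Fin p → ℝ) :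
    x ⬝ᵥ (D.ricc P *ᵥ x) ≤ D.stageCost x u
      + D.β * ((D.A *ᵥ x + D.B *ᵥ u) ⬝ᵥ (P *ᵥ (D.A *ᵥ x + D.B *ᵥ u))) := by
  rw [complete_square hP hM]
  linarith [(posSemidef_real_iff.mp hM.posSemidef).2 (u + D.gain P *ᵥ x)]

theorem ricc_eq {P : Matrix (Fin q) (Fin q) ℝ} (hP : Pᵀ = P)
    (hM : (D.gainDen P).PosDef) (x : Fin q → ℝ) :
    D.stageCost x (-(D.gain P *ᵥ x))
      + D.β * ((D.A *ᵥ x + D.B *ᵥ (-(D.gain P *ᵥ x)))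
          ⬝ᵥ (P *ᵥ (D.A *ᵥ x + D.B *ᵥ (-(D.gain P *ᵥ x)))))
      = x ⬝ᵥ (D.ricc P *ᵥ x) := by
  rw [complete_square hP hM]
  simp

theorem stageCost_nonneg (hQ : D.Q.PosSemidef) (hR : D.R.PosDef) (x : Fin q → ℝ)
    (u : Fin p → ℝ) : 0 ≤ D.stageCost x u :=
  add_nonneg ((posSemidef_real_iff.mp hQ).2 x) ((posSemidef_real_iff.mp hR.posSemidef).2 u)

theorem ricc_posSemidef (hQ : D.Q.PosSemidef) (hR : D.R.PosDef) (hβ : 0 ≤ D.β)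
    {P : Matrix (Fin q) (Fin q) ℝ} (hP : P.PosSemidef) : (D.ricc P).PosSemidef := by
  have hM := gainDen_posDef hR hβ hP
  have hPt := (posSemidef_real_iff.mp hP).1
  refine posSemidef_real_iff.mpr ⟨?_, fun x => ?_⟩
  · rw [ricc, transpose_sub, transpose_add, transpose_smul,
      (posSemidef_real_iff.mp (phi_posSemidef hR hβ hP)).1, (posSemidef_real_iff.mp hQ).1]
    simp only [transpose_mul, transpose_transpose, hPt, Matrix.mul_assoc]
  · rw [← ricc_eq hPt hM]
    exact add_nonneg (stageCost_nonneg hQ hR _ _)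
      (mul_nonneg hβ ((posSemidef_real_iff.mp hP).2 _))

/-- A minimum over controls inherits monotonicity in the terminal cost: the control that is optimal
for `P'` is merely admissible for `P`. -/
theorem ricc_mono (hR : D.R.PosDef) (hβ : 0 ≤ D.β) {P P' : Matrix (Fin q) (Fin q) ℝ}
    (hP : P.PosSemidef) (hP' : P'.PosSemidef)
    (h : ∀ x : Fin q → ℝ, x ⬝ᵥ (P *ᵥ x) ≤ x ⬝ᵥ (P' *ᵥ x)) (x : Fin q → ℝ) :
    x ⬝ᵥ (D.ricc P *ᵥ x) ≤ x ⬝ᵥ (D.ricc P' *ᵥ x) := by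
  rw [← ricc_eq (posSemidef_real_iff.mp hP').1 (gainDen_posDef hR hβ hP')]
  refine (ricc_le (posSemidef_real_iff.mp hP).1 (gainDen_posDef hR hβ hP) _
    (-(D.gain P' *ᵥ x))).trans ?_
  gcongr
  exact h _

end LQGData

/-! ### Open-loop trajectories, controllability and observability. -/

namespace LQGData

variable {q p s m : ℕ} (D : LQGData q p s)

theorem openLoop_add_time (u : ℕ → Fin p → ℝ) (w : ℕ → Fin s → ℝ) (x : Fin q → ℝ) (k t : ℕ) :
    D.openLoop u w x (k + t)
      = D.openLoop (fun j => u (k + j)) (fun j => w (k + j)) (D.openLoop u w x k) t := by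
  induction t with
  | zero => rfl
  | succ t ih => rw [← add_assoc, openLoop, openLoop, ih]

/-- Superposition. It separates the initial state, the controls and the noise wherever that is
needed below. -/
theorem openLoop_add (u u' : ℕ → Fin p → ℝ) (w w' : ℕ → Fin s → ℝ) (x x' : Fin q → ℝ) (t : ℕ) :
    D.openLoop (u + u') (w + w') (x + x') t = D.openLoop u w x t + D.openLoop u' w' x' t := by
  induction t with
  | zero => rfl
  | succ t ih =>
    simp only [openLoop, step, ih, Pi.add_apply, mulVec_add]
    abel

/-- The state is the sum of the noiseless state and the estimation error. -/
theorem openLoop_eq_add_noise (u : ℕ → Fin p → ℝ) (w : ℕ → Fin s → ℝ) (x : Fin q → ℝ) (t : ℕ) :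
    D.openLoop u w x t = D.openLoop u 0 x t + D.openLoop 0 w 0 t := by
  simpa using D.openLoop_add u 0 0 w x 0 t

theorem openLoop_zero_zero (x : Fin q → ℝ) (t : ℕ) : D.openLoop 0 0 x t = D.A ^ t *ᵥ x := by
  induction t with
  | zero => simp [openLoop]
  | succ t ih => simp [openLoop, step, ih, pow_succ']

theorem openLoop_noiseless_succ (u : ℕ → Fin p → ℝ) (x : Fin q → ℝ) (t : ℕ) :
    D.openLoop u 0 x (t + 1) = D.A *ᵥ D.openLoop u 0 x t + D.B *ᵥ u t := by
  simp [openLoop, step]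

variable {D}

/-- The noiseless effect of the controls on the state, as a combination of the blocks of the
controllability matrix. -/
theorem openLoop_controls (v : Fin q × Fin p → ℝ) :
    D.openLoop (fun t j => if h : t < q then v (⟨q - 1 - t, by omega⟩, j) else 0) 0 0 q
      = (Matrix.of fun (i : Fin q) (kj : Fin q × Fin p) => (D.A ^ (kj.1 : ℕ) * D.B) i kj.2) *ᵥ v := by
  have key : ∀ (u : ℕ → Fin p → ℝ) (t : ℕ),
      D.openLoop u 0 0 t = ∑ k ∈ Finset.range t, (D.A ^ (t - 1 - k) * D.B) *ᵥ u k := by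
    intro u t
    induction t with
    | zero => rfl
    | succ t ih =>
      rw [openLoop_noiseless_succ, ih, Finset.sum_range_succ, mulVec_sum]
      congr 1
      · refine Finset.sum_congr rfl fun k hk => ?_
        have hk := Finset.mem_range.mp hk
        rw [mulVec_mulVec, ← Matrix.mul_assoc, ← pow_succ']
        congr 3
        omega
      · simp
  -- The control at time `k` reaches time `q` through `A ^ (q - 1 - k)`, so the order of time is
  -- reversed relative to the blocks.
  rw [key, ← Finset.sum_range_reflect, Finset.sum_range]
  ext i
  rw [Finset.sum_apply]
  simp only [mulVec, dotProduct, Fintype.sum_prod_type, of_apply]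
  refine Finset.sum_congr rfl fun k _ => Finset.sum_congr rfl fun j _ => ?_
  have hk := k.2
  have h1 : q - 1 - (q - 1 - (k : ℕ)) = k := by omega
  rw [dif_pos (by omega)]
  simp only [h1]

theorem mulVec_surjective_of_rank {ι : Type*} [Fintype ι] (M : Matrix (Fin q) ι ℝ)
    (h : M.rank = q) : Function.Surjective M.mulVec := by
  have : LinearMap.range M.mulVecLin = ⊤ := by
    apply Submodule.eq_top_of_finrank_eq
    rw [← Matrix.rank, h]
    simp
  exact LinearMap.range_eq_top.mp this

/-- Controllability: the noiseless system can be steered to the origin in `q` steps. -/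
theorem IsControllable.exists_control (hAB : IsControllable D.A D.B) (x : Fin q → ℝ) :
    ∃ u : ℕ → Fin p → ℝ, (∀ t, q ≤ t → u t = 0) ∧ ∀ t, q ≤ t → D.openLoop u 0 x t = 0 := by
  obtain ⟨v, hv⟩ := mulVec_surjective_of_rank _ hAB (-(D.A ^ q *ᵥ x))
  set u : ℕ → Fin p → ℝ := fun t j => if h : t < q then v (⟨q - 1 - t, by omega⟩, j) else 0
    with hu
  have hu0 : ∀ t, q ≤ t → u t = 0 := fun t ht => by
    ext j
    simp [hu, Nat.not_lt.mpr ht]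
  refine ⟨u, hu0, fun t ht => ?_⟩
  induction t, ht using Nat.le_induction with
  | base =>
    have := D.openLoop_add u 0 0 0 0 x q
    simp only [add_zero, zero_add] at this
    rw [this, openLoop_zero_zero, hu, openLoop_controls]
    erw [hv]
    simp
  | succ t ht ih => rw [openLoop_noiseless_succ, ih, hu0 t ht]; simp

section Observability

variable {J : Matrix (Fin m) (Fin q) ℝ}

theorem quadForm_of_eq_transpose_mul {Q : Matrix (Fin q) (Fin q) ℝ} (hQ : Q = Jᵀ * J)
    (x : Fin q → ℝ) : x ⬝ᵥ (Q *ᵥ x) = (J *ᵥ x) ⬝ᵥ (J *ᵥ x) := by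
  rw [dotProduct_mulVec_mulVec_self, hQ]

theorem posSemidef_of_eq_transpose_mul {Q : Matrix (Fin q) (Fin q) ℝ} (hQ : Q = Jᵀ * J) :
    Q.PosSemidef := by
  rw [hQ, ← conjTranspose_eq_transpose_of_trivial]
  exact posSemidef_conjTranspose_mul_self J

/-- Observability bounds the initial state by the outputs of the free system. -/
theorem IsObservable.exists_sq_le (hAJ : IsObservable D.A J) :
    ∃ c : ℝ, 0 ≤ c ∧ ∀ x : Fin q → ℝ,
      x ⬝ᵥ x ≤ c * ∑ t ∈ Finset.range q, (J *ᵥ (D.A ^ t *ᵥ x)) ⬝ᵥ (J *ᵥ (D.A ^ t *ᵥ x)) := by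
  set G := Matrix.of fun (ki : Fin q × Fin m) (j : Fin q) => (J * D.A ^ (ki.1 : ℕ)) ki.2 j with hG
  have hinj : Function.Injective G.mulVec := by
    have h1 : LinearMap.ker G.mulVecLin = ⊥ := by
      have h2 := G.mulVecLin.finrank_range_add_finrank_ker
      have h3 : Module.finrank ℝ (LinearMap.range G.mulVecLin) = q := hAJ
      rw [h3] at h2
      simp only [Module.finrank_fintype_fun_eq_card, Fintype.card_fin, Nat.add_eq_left] at h2
      exact Submodule.finrank_eq_zero.mp h2
    exact LinearMap.ker_eq_bot.mp h1
  have hpd : (Gᵀ * G).PosDef := by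
    rw [← conjTranspose_eq_transpose_of_trivial]
    exact PosDef.conjTranspose_mul_self G hinj
  obtain ⟨c, hc, h⟩ := exists_sq_le_of_posDef hpd
  refine ⟨c, hc, fun x => (h x).trans_eq ?_⟩
  rw [← mulVec_mulVec, dotProduct_transpose_mulVec, Finset.sum_range]
  simp only [dotProduct, Fintype.sum_prod_type, mulVec_mulVec]
  rfl

/-- The cost of `q` steps together with the noise bounds the initial state. -/
theorem exists_sq_le_stageCost (hQ : D.Q = Jᵀ * J) (hR : D.R.PosDef)
    (hAJ : IsObservable D.A J) :
    ∃ c : ℝ, 0 ≤ c ∧ ∀ (u : ℕ → Fin p → ℝ) (w : ℕ → Fin s → ℝ) (x : Fin q → ℝ),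
      x ⬝ᵥ x ≤ c * ∑ t ∈ Finset.range q,
        (D.stageCost (D.openLoop u w x t) (u t) + w t ⬝ᵥ w t) := by
  have hQ' := posSemidef_of_eq_transpose_mul hQ
  obtain ⟨c₀, hc₀, h₀⟩ := IsObservable.exists_sq_le (D := D) hAJ
  obtain ⟨a, ha, hA⟩ := exists_mulVec_sq_le D.A
  obtain ⟨b, hb, hB⟩ := exists_mulVec_sq_le D.B
  obtain ⟨d, hd, hC⟩ := exists_mulVec_sq_le D.C
  obtain ⟨e, he, hJ⟩ := exists_mulVec_sq_le J
  obtain ⟨ρ, hρ, hR'⟩ := exists_sq_le_of_posDef hR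
  set F : (ℕ → Fin p → ℝ) → (ℕ → Fin s → ℝ) → (Fin q → ℝ) → ℕ → ℝ := fun u w x N =>
    ∑ t ∈ Finset.range N, (D.stageCost (D.openLoop u w x t) (u t) + w t ⬝ᵥ w t) with hF
  have hterm : ∀ u w x t, 0 ≤ D.stageCost (D.openLoop u w x t) (u t) + w t ⬝ᵥ w t :=
    fun u w x t => add_nonneg (stageCost_nonneg hQ' hR _ _) (dotProduct_self_nonneg' _)
  have hmono : ∀ u w x, Monotone (F u w x) := fun u w x =>
    monotone_nat_of_le_succ fun n => by
      simp only [hF, Finset.sum_range_succ]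
      linarith [hterm u w x n]
  have hpos : ∀ u w x N, 0 ≤ F u w x N := fun u w x N => Finset.sum_nonneg fun t _ => hterm u w x t
  -- Controls and noise move the trajectory away from the free one by an amount that `F` controls.
  -- The bound may use `F` at any initial state `x`, because only the part `u'Ru` of the stage cost
  -- enters.
  have hdev : ∀ t, ∃ k : ℝ, 0 ≤ k ∧ ∀ u w x,
      D.openLoop u w 0 t ⬝ᵥ D.openLoop u w 0 t ≤ k * F u w x t := by
    intro t
    induction t with
    | zero => exact ⟨0, le_rfl, fun u w x => by simp [openLoop]⟩
    | succ t ih =>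
      obtain ⟨k, hk, ih⟩ := ih
      refine ⟨4 * a * k + 4 * b * ρ + 2 * d, by positivity, fun u w x => ?_⟩
      have h1 := ih u w x
      have h2 := hR' (u t)
      have h3 : u t ⬝ᵥ (D.R *ᵥ u t) ≤ D.stageCost (D.openLoop u w x t) (u t) := by
        have := (posSemidef_real_iff.mp hQ').2 (D.openLoop u w x t)
        rw [stageCost]
        linarith
      have h4 := hA (D.openLoop u w 0 t)
      have h5 := hB (u t)
      have h6 := hC (w t)
      have h7 := dotProduct_self_add_le (D.A *ᵥ D.openLoop u w 0 t + D.B *ᵥ u t) (D.C *ᵥ w t)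
      have h8 := dotProduct_self_add_le (D.A *ᵥ D.openLoop u w 0 t) (D.B *ᵥ u t)
      have hFs : F u w x (t + 1)
          = F u w x t + (D.stageCost (D.openLoop u w x t) (u t) + w t ⬝ᵥ w t) := by
        simp only [hF, Finset.sum_range_succ]
      have h9 := stageCost_nonneg hQ' hR (D.openLoop u w x t) (u t)
      have h10 := dotProduct_self_nonneg' (w t)
      have h11 := hpos u w x t
      have g1 : a * (D.openLoop u w 0 t ⬝ᵥ D.openLoop u w 0 t) ≤ a * k * F u w x (t + 1) := by
        rw [mul_assoc]
        refine mul_le_mul_of_nonneg_left (h1.trans ?_) ha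
        exact mul_le_mul_of_nonneg_left (by linarith) hk
      have g2 : b * (u t ⬝ᵥ u t) ≤ b * ρ * F u w x (t + 1) := by
        rw [mul_assoc]
        refine mul_le_mul_of_nonneg_left (h2.trans ?_) hb
        exact mul_le_mul_of_nonneg_left (by linarith) hρ
      have g3 : d * (w t ⬝ᵥ w t) ≤ d * F u w x (t + 1) :=
        mul_le_mul_of_nonneg_left (by linarith) hd
      rw [openLoop, step]
      linarith
  choose k hk hdev using hdev
  refine ⟨c₀ * ∑ t ∈ Finset.range q, (2 + 2 * (e * k t)),
    mul_nonneg hc₀ (Finset.sum_nonneg fun t _ => by have := hk t; positivity), fun u w x => ?_⟩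
  rw [mul_assoc, Finset.sum_mul]
  refine (h₀ x).trans (mul_le_mul_of_nonneg_left (Finset.sum_le_sum fun t ht => ?_) hc₀)
  have ht := Finset.mem_range.mp ht
  -- The free trajectory, which observability sees, is the actual one minus the deviation. The stage
  -- costs bound the output of the first, `hdev` that of the second.
  have hx : D.A ^ t *ᵥ x = D.openLoop u w x t + -D.openLoop u w 0 t := by
    have := D.openLoop_add u 0 w 0 0 x t
    simp only [add_zero, zero_add] at this
    rw [this, openLoop_zero_zero]
    abel
  have h1 := dotProduct_self_add_le (J *ᵥ D.openLoop u w x t) (J *ᵥ -D.openLoop u w 0 t)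
  rw [← mulVec_add, ← hx, mulVec_neg, neg_dotProduct_neg] at h1
  have h2 : (J *ᵥ D.openLoop u w x t) ⬝ᵥ (J *ᵥ D.openLoop u w x t) ≤ F u w x q := by
    rw [← quadForm_of_eq_transpose_mul hQ]
    refine le_trans ?_ (hmono u w x ht)
    simp only [hF, Finset.sum_range_succ]
    have := hpos u w x t
    have := dotProduct_self_nonneg' (w t)
    have := (posSemidef_real_iff.mp hR.posSemidef).2 (u t)
    simp only [stageCost, hF] at *
    linarith
  have h3 : (J *ᵥ D.openLoop u w 0 t) ⬝ᵥ (J *ᵥ D.openLoop u w 0 t) ≤ e * k t * F u w x q := by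
    refine (hJ _).trans ?_
    rw [mul_assoc]
    refine mul_le_mul_of_nonneg_left ((hdev t u w x).trans ?_) he
    exact mul_le_mul_of_nonneg_left (hmono u w x ht.le) (hk t)
  change _ ≤ _ * F u w x q
  linarith

end Observability

end LQGData

/-! ### The Riccati equation: noiseless costs, uniqueness, existence. -/

namespace LQGData

open Filter Topology

variable {q p s m : ℕ} {D : LQGData q p s} {J : Matrix (Fin m) (Fin q) ℝ}

variable (D) in
/-- The open-loop controls obtained from the optimal gain applied to the noiseless state. -/
noncomputable def feedback (P : Matrix (Fin q) (Fin q) ℝ) (t : ℕ) (x : Fin q → ℝ) : Fin p → ℝ :=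
  -(D.gain P *ᵥ ((D.A - D.B * D.gain P) ^ t *ᵥ x))

theorem openLoop_feedback (P : Matrix (Fin q) (Fin q) ℝ) (x : Fin q → ℝ) (t : ℕ) :
    D.openLoop (fun t => D.feedback P t x) 0 x t = (D.A - D.B * D.gain P) ^ t *ᵥ x := by
  induction t with
  | zero => simp [openLoop]
  | succ t ih =>
    rw [openLoop_noiseless_succ, ih, feedback, mulVec_neg, mulVec_mulVec _ D.B, ← sub_eq_add_neg,
      ← sub_mulVec, mulVec_mulVec, ← pow_succ']

theorem feedback_add_gain (P : Matrix (Fin q) (Fin q) ℝ) (x : Fin q → ℝ) (t : ℕ) :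
    D.feedback P t x + D.gain P *ᵥ D.openLoop (fun t => D.feedback P t x) 0 x t = 0 := by
  rw [openLoop_feedback, feedback, neg_add_cancel]

/-- The noiseless cost with terminal cost `P`, for a solution `P` of the Riccati equation. -/
theorem noiseless_cost {P : Matrix (Fin q) (Fin q) ℝ} (hP : Pᵀ = P)
    (hM : (D.gainDen P).PosDef) (hric : D.Riccati P) (u : ℕ → Fin p → ℝ) (x : Fin q → ℝ)
    (T : ℕ) :
    ∑ t ∈ Finset.range T, D.β ^ t * D.stageCost (D.openLoop u 0 x t) (u t)
        + D.β ^ T * (D.openLoop u 0 x T ⬝ᵥ (P *ᵥ D.openLoop u 0 x T))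
      = x ⬝ᵥ (P *ᵥ x) + ∑ t ∈ Finset.range T, D.β ^ t *
          ((u t + D.gain P *ᵥ D.openLoop u 0 x t)
            ⬝ᵥ (D.gainDen P *ᵥ (u t + D.gain P *ᵥ D.openLoop u 0 x t))) := by
  induction T with
  | zero => simp [openLoop]
  | succ T ih =>
    have h := complete_square hP hM (D.openLoop u 0 x T) (u T)
    rw [← riccati_iff.mp hric, ← openLoop_noiseless_succ] at h
    rw [Finset.sum_range_succ, Finset.sum_range_succ, ← add_assoc, ← ih, pow_succ]
    linear_combination D.β ^ T * h

theorem quadForm_le_noiseless_cost {P : Matrix (Fin q) (Fin q) ℝ} (hβ : 0 ≤ D.β) (hP : Pᵀ = P)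
    (hM : (D.gainDen P).PosDef) (hric : D.Riccati P) (u : ℕ → Fin p → ℝ) (x : Fin q → ℝ)
    (T : ℕ) :
    x ⬝ᵥ (P *ᵥ x) ≤ ∑ t ∈ Finset.range T, D.β ^ t * D.stageCost (D.openLoop u 0 x t) (u t)
        + D.β ^ T * (D.openLoop u 0 x T ⬝ᵥ (P *ᵥ D.openLoop u 0 x T)) := by
  rw [noiseless_cost hP hM hric, le_add_iff_nonneg_right]
  exact Finset.sum_nonneg fun t _ => mul_nonneg (pow_nonneg hβ t)
    ((posSemidef_real_iff.mp hM.posSemidef).2 _)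

theorem noiseless_cost_feedback {P : Matrix (Fin q) (Fin q) ℝ} (hP : Pᵀ = P)
    (hM : (D.gainDen P).PosDef) (hric : D.Riccati P) (x : Fin q → ℝ) (T : ℕ) :
    ∑ t ∈ Finset.range T, D.β ^ t *
          D.stageCost (D.openLoop (fun t => D.feedback P t x) 0 x t) (D.feedback P t x)
        + D.β ^ T * (D.openLoop (fun t => D.feedback P t x) 0 x T
            ⬝ᵥ (P *ᵥ D.openLoop (fun t => D.feedback P t x) 0 x T))
      = x ⬝ᵥ (P *ᵥ x) := by
  rw [noiseless_cost hP hM hric (fun t => D.feedback P t x)]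
  simp [feedback_add_gain]

theorem noiseless_cost_feedback_le {P : Matrix (Fin q) (Fin q) ℝ} (hR : D.R.PosDef)
    (hβ : 0 ≤ D.β) (hP : P.PosSemidef) (hric : D.Riccati P) (x : Fin q → ℝ) (T : ℕ) :
    ∑ t ∈ Finset.range T, D.β ^ t *
          D.stageCost (D.openLoop (fun t => D.feedback P t x) 0 x t) (D.feedback P t x)
      ≤ x ⬝ᵥ (P *ᵥ x) := by
  have h := posSemidef_real_iff.mp hP
  rw [← noiseless_cost_feedback h.1 (gainDen_posDef hR hβ hP) hric x T, le_add_iff_nonneg_right]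
  exact mul_nonneg (pow_nonneg hβ T) (h.2 _)

section Uniqueness

variable (hQ : D.Q = Jᵀ * J) (hR : D.R.PosDef) (hβ : 0 < D.β) (hAJ : IsObservable D.A J)
include hQ hR hβ hAJ

/-- Along controls of finite noiseless cost the discounted state tends to `0`. -/
theorem tendsto_discounted_sq (u : ℕ → Fin p → ℝ) (x : Fin q → ℝ) {b : ℝ}
    (hb : ∀ T, ∑ t ∈ Finset.range T, D.β ^ t * D.stageCost (D.openLoop u 0 x t) (u t) ≤ b) :
    Tendsto (fun n => D.β ^ n * (D.openLoop u 0 x n ⬝ᵥ D.openLoop u 0 x n)) atTop (𝓝 0) := by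
  have hQ' := posSemidef_of_eq_transpose_mul hQ
  obtain ⟨c, hc, h⟩ := exists_sq_le_stageCost hQ hR hAJ
  have hnn : ∀ t, 0 ≤ D.β ^ t * D.stageCost (D.openLoop u 0 x t) (u t) := fun t =>
    mul_nonneg (pow_nonneg hβ.le t) (stageCost_nonneg hQ' hR _ _)
  have h0 := (summable_of_sum_range_le hnn hb).tendsto_atTop_zero
  -- Observability is applied to the window of `q` steps from time `n`. The factors `(β ^ t)⁻¹` undo
  -- the discount inside the window, and finitely many terms of a summable series tend to `0`.
  have hlim : Tendsto (fun n => c * ∑ t ∈ Finset.range q, (D.β ^ t)⁻¹ *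
      (D.β ^ (n + t) * D.stageCost (D.openLoop u 0 x (n + t)) (u (n + t)))) atTop (𝓝 0) := by
    have : Tendsto (fun n => c * ∑ t ∈ Finset.range q, (D.β ^ t)⁻¹ *
      (D.β ^ (n + t) * D.stageCost (D.openLoop u 0 x (n + t)) (u (n + t)))) atTop
        (𝓝 (c * ∑ t ∈ Finset.range q, (D.β ^ t)⁻¹ * 0)) :=
      (tendsto_finsetSum _ fun t _ =>
        (h0.comp (tendsto_add_atTop_nat t)).const_mul _).const_mul _
    simpa using this
  refine squeeze_zero (fun n => mul_nonneg (pow_nonneg hβ.le n) (dotProduct_self_nonneg' _))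
    (fun n => ?_) hlim
  have h1 := h (fun j => u (n + j)) 0 (D.openLoop u 0 x n)
  have h2 : ∀ t, D.openLoop (fun j => u (n + j)) 0 (D.openLoop u 0 x n) t
      = D.openLoop u 0 x (n + t) := fun t => (D.openLoop_add_time u 0 x n t).symm
  simp only [h2, Pi.zero_apply, dotProduct_zero, add_zero] at h1
  refine (mul_le_mul_of_nonneg_left h1 (pow_nonneg hβ.le n)).trans_eq ?_
  rw [mul_left_comm, Finset.mul_sum]
  congr 1
  refine Finset.sum_congr rfl fun t _ => ?_
  have := pow_pos hβ t
  field_simp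
  ring

/-- The feedback of `P` costs at most `x'Px` over any horizon. By `P'`, the same controls cost at
least `x'P'x` minus a discounted terminal form, which tends to `0`. The roles are then exchanged to
get uniqueness. -/
theorem riccati_quadForm_le {P P' : Matrix (Fin q) (Fin q) ℝ} (hP : P.PosSemidef)
    (hP' : P'.PosSemidef) (hric : D.Riccati P) (hric' : D.Riccati P') (x : Fin q → ℝ) :
    x ⬝ᵥ (P' *ᵥ x) ≤ x ⬝ᵥ (P *ᵥ x) := by
  obtain ⟨c, hc, h⟩ := exists_quadForm_le P'
  have hb := noiseless_cost_feedback_le hR hβ.le hP hric x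
  have hlim := ((tendsto_discounted_sq hQ hR hβ hAJ _ x hb).const_mul c).const_add
    (x ⬝ᵥ (P *ᵥ x))
  rw [mul_zero, add_zero] at hlim
  refine ge_of_tendsto' hlim fun n => ?_
  refine (quadForm_le_noiseless_cost hβ.le (posSemidef_real_iff.mp hP').1
    (gainDen_posDef hR hβ.le hP') hric' (fun t => D.feedback P t x) x n).trans ?_
  refine add_le_add (hb n) ?_
  rw [mul_left_comm]
  exact mul_le_mul_of_nonneg_left (h _) (pow_nonneg hβ.le n)

theorem riccati_unique {P P' : Matrix (Fin q) (Fin q) ℝ} (hP : P.PosSemidef)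
    (hP' : P'.PosSemidef) (hric : D.Riccati P) (hric' : D.Riccati P') : P' = P :=
  eq_of_quadForm_eq (posSemidef_real_iff.mp hP').1 (posSemidef_real_iff.mp hP).1 fun x =>
    le_antisymm (riccati_quadForm_le hQ hR hβ hAJ hP hP' hric hric' x)
      (riccati_quadForm_le hQ hR hβ hAJ hP' hP hric' hric x)

/-- If the form vanishes at `x`, the feedback runs `q` steps at no cost, and observability forces `x
= 0`. -/
theorem riccati_posDef {P : Matrix (Fin q) (Fin q) ℝ} (hP : P.PosSemidef)
    (hric : D.Riccati P) : P.PosDef := by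
  have hP' := posSemidef_real_iff.mp hP
  refine posDef_real_iff.mpr ⟨hP'.1, fun x hx => (hP'.2 x).lt_of_ne fun h0 => hx ?_⟩
  obtain ⟨c, hc, h⟩ := exists_sq_le_stageCost hQ hR hAJ
  have hb := noiseless_cost_feedback_le hR hβ.le hP hric x q
  rw [← h0] at hb
  have hQ' := posSemidef_of_eq_transpose_mul hQ
  have h1 := h (fun t => D.feedback P t x) 0 x
  have hz : ∀ t ∈ Finset.range q,
      D.stageCost (D.openLoop (fun t => D.feedback P t x) 0 x t) (D.feedback P t x) = 0 := by
    intro t ht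
    have h2 := (Finset.sum_eq_zero_iff_of_nonneg (fun t _ => mul_nonneg (pow_nonneg hβ.le t)
      (stageCost_nonneg hQ' hR _ _))).mp (le_antisymm hb (Finset.sum_nonneg fun t _ =>
        mul_nonneg (pow_nonneg hβ.le t) (stageCost_nonneg hQ' hR _ _))) t ht
    exact (mul_eq_zero.mp h2).resolve_left (pow_pos hβ t).ne'
  rw [Finset.sum_congr rfl fun t ht => by rw [hz t ht, Pi.zero_apply, dotProduct_zero, add_zero],
    Finset.sum_const_zero, mul_zero] at h1
  exact dotProduct_self_eq_zero.mp (le_antisymm h1 (dotProduct_self_nonneg' x))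

end Uniqueness

section Existence

theorem continuousAt_matrix_inv {n : ℕ} {M : Matrix (Fin n) (Fin n) ℝ} (hM : M.det ≠ 0) :
    ContinuousAt (fun N : Matrix (Fin n) (Fin n) ℝ => N⁻¹) M := by
  simp only [Matrix.inv_def, Ring.inverse_eq_inv']
  exact (ContinuousAt.inv₀ (Continuous.matrix_det continuous_id).continuousAt hM).smul
    (Continuous.matrix_adjugate continuous_id).continuousAt

theorem continuousAt_ricc {P : Matrix (Fin q) (Fin q) ℝ} (hM : (D.gainDen P).PosDef) :
    ContinuousAt D.ricc P := by
  have hdet : (D.gainDen P).det ≠ 0 := ((isUnit_iff_isUnit_det _).mp hM.isUnit).ne_zero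
  have hinv : ContinuousAt (fun P => (D.gainDen P)⁻¹) P :=
    ContinuousAt.comp (f := D.gainDen) (continuousAt_matrix_inv hdet)
      (by unfold gainDen; fun_prop)
  have hmul : ∀ {a b c : ℕ} {f : Matrix (Fin q) (Fin q) ℝ → Matrix (Fin a) (Fin b) ℝ}
      {g : Matrix (Fin q) (Fin q) ℝ → Matrix (Fin b) (Fin c) ℝ}, ContinuousAt f P →
      ContinuousAt g P → ContinuousAt (fun P => f P * g P) P := fun hf hg =>
    ((continuous_fst.matrix_mul continuous_snd).continuousAt).comp (hf.prodMk hg)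
  have h1 : Continuous fun P : Matrix (Fin q) (Fin q) ℝ => D.Q + D.β • (D.Aᵀ * P * D.A) := by fun_prop
  have h2 : Continuous fun P : Matrix (Fin q) (Fin q) ℝ => D.Aᵀ * P * D.B := by fun_prop
  have h3 : Continuous fun P : Matrix (Fin q) (Fin q) ℝ => D.β • (D.Bᵀ * P * D.A) := by fun_prop
  exact h1.continuousAt.sub (hmul (hmul h2.continuousAt (hinv.const_smul D.β)) h3.continuousAt)

/-- Value iteration from `0` is the optimal noiseless cost over `n` steps without terminal cost, so
every control sequence bounds it. Semidefiniteness belongs to the same induction because the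
one-step inequality requires it. -/
theorem quadForm_iterate_le (hQ : D.Q.PosSemidef) (hR : D.R.PosDef) (hβ : 0 ≤ D.β) (n : ℕ)
    (u : ℕ → Fin p → ℝ) (x : Fin q → ℝ) :
    (D.ricc^[n] 0).PosSemidef ∧ x ⬝ᵥ (D.ricc^[n] 0 *ᵥ x)
      ≤ ∑ t ∈ Finset.range n, D.β ^ t * D.stageCost (D.openLoop u 0 x t) (u t) := by
  induction n generalizing u x with
  | zero => simpa using PosSemidef.zero
  | succ n ih =>
    have hP := (ih u x).1
    rw [Function.iterate_succ_apply']
    refine ⟨ricc_posSemidef hQ hR hβ hP, (ricc_le (posSemidef_real_iff.mp hP).1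
      (gainDen_posDef hR hβ hP) x (u 0)).trans ?_⟩
    rw [Finset.sum_range_succ', add_comm]
    refine add_le_add ?_ (by simp [openLoop])
    have h := (ih (fun j => u (1 + j)) (D.openLoop u 0 x 1)).2
    rw [openLoop_noiseless_succ, openLoop] at h
    refine (mul_le_mul_of_nonneg_left h hβ).trans_eq ?_
    rw [Finset.mul_sum]
    refine Finset.sum_congr rfl fun t _ => ?_
    have h2 := D.openLoop_add_time u 0 x 1 t
    rw [openLoop_noiseless_succ, openLoop] at h2
    rw [add_comm t 1, h2, pow_add, pow_one, mul_assoc]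
    rfl

/-- The Riccati equation has a positive semidefinite solution, the limit of the value iteration
started from `0`. -/
theorem exists_riccati (hQ : D.Q.PosSemidef) (hR : D.R.PosDef) (hβ : 0 ≤ D.β)
    (hAB : IsControllable D.A D.B) :
    ∃ P : Matrix (Fin q) (Fin q) ℝ, P.PosSemidef ∧ D.Riccati P := by
  set X : ℕ → Matrix (Fin q) (Fin q) ℝ := fun n => D.ricc^[n] 0 with hX
  have hXs : ∀ n, X (n + 1) = D.ricc (X n) := fun n => Function.iterate_succ_apply' _ _ _
  have hpsd : ∀ n, (X n).PosSemidef := fun n => (quadForm_iterate_le hQ hR hβ n 0 0).1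
  have hsym : ∀ n, (X n)ᵀ = X n := fun n => (posSemidef_real_iff.mp (hpsd n)).1
  have hmono : ∀ x : Fin q → ℝ, Monotone fun n => x ⬝ᵥ (X n *ᵥ x) := by
    have : ∀ n, ∀ x : Fin q → ℝ, x ⬝ᵥ (X n *ᵥ x) ≤ x ⬝ᵥ (X (n + 1) *ᵥ x) := by
      intro n
      induction n with
      | zero => exact fun x => by simpa [hX] using (posSemidef_real_iff.mp (hpsd 1)).2 x
      | succ n ih =>
        rw [hXs (n + 1), hXs n]
        exact ricc_mono hR hβ (hpsd n) (by rw [← hXs]; exact hpsd _) (by rw [← hXs]; exact ih)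
    exact fun x => monotone_nat_of_le_succ fun n => this n x
  have hconv : ∀ x : Fin q → ℝ, ∃ l, Tendsto (fun n => x ⬝ᵥ (X n *ᵥ x)) atTop (𝓝 l) := by
    intro x
    obtain ⟨u, hu, hx⟩ := IsControllable.exists_control hAB x
    refine ⟨_, tendsto_atTop_ciSup (hmono x)
      ⟨∑ t ∈ Finset.range q, D.β ^ t * D.stageCost (D.openLoop u 0 x t) (u t), ?_⟩⟩
    rintro _ ⟨n, rfl⟩
    -- The steering controls cost nothing after time `q`, so the bound does not grow with the
    -- horizon.
    refine ((hmono x) (le_max_left n q)).trans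
      ((quadForm_iterate_le hQ hR hβ _ u x).2.trans_eq ?_)
    refine (Finset.sum_subset (Finset.range_subset_range.mpr (le_max_right n q))
      fun t _ ht => ?_).symm
    have ht : q ≤ t := by simpa using ht
    rw [hu t ht, hx t ht]
    simp [stageCost]
  -- Polarization: convergence of the forms gives convergence of the entries.
  have hentry : ∀ i j, ∃ l, Tendsto (fun n => X n i j) atTop (𝓝 l) := by
    intro i j
    obtain ⟨l₁, h₁⟩ := hconv (Pi.single i 1 + Pi.single j 1)
    obtain ⟨l₂, h₂⟩ := hconv (Pi.single i 1)
    obtain ⟨l₃, h₃⟩ := hconv (Pi.single j 1)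
    refine ⟨(l₁ - l₂ - l₃) / 2, (((h₁.sub h₂).sub h₃).div_const 2).congr fun n => ?_⟩
    rw [quadForm_add (hsym n)]
    simp only [single_one_dotProduct, mulVec_single_one, col_apply]
    ring
  choose P hP using hentry
  have hlim : Tendsto X atTop (𝓝 (Matrix.of P)) :=
    tendsto_pi_nhds.mpr fun i => tendsto_pi_nhds.mpr fun j => hP i j
  have hPpsd : (Matrix.of P).PosSemidef := by
    refine posSemidef_real_iff.mpr ⟨?_, fun x => ?_⟩
    · ext i j
      refine tendsto_nhds_unique (hP j i) ((hP i j).congr fun n => ?_)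
      conv_lhs => rw [← hsym n, transpose_apply]
    · have : Continuous fun N : Matrix (Fin q) (Fin q) ℝ => x ⬝ᵥ (N *ᵥ x) := by fun_prop
      exact ge_of_tendsto' ((this.tendsto _).comp hlim) fun n => (posSemidef_real_iff.mp (hpsd n)).2 x
  refine ⟨Matrix.of P, hPpsd, riccati_iff.mpr ?_⟩
  have h1 := (hlim.comp (tendsto_add_atTop_nat 1))
  have h2 := (continuousAt_ricc (gainDen_posDef hR hβ hPpsd)).tendsto.comp hlim
  exact tendsto_nhds_unique h1 (h2.congr fun n => (hXs n).symm)

end Existence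

end LQGData

/-! ### Second moments and the expected cost of one period. -/

section Moments

variable {Ω : Type*} [MeasurableSpace Ω] {μ : Measure Ω} [IsProbabilityMeasure μ]

/-- The expectation of a quadratic form of a random vector with mean `v` and covariance `Σ`. -/
theorem integral_quadForm {n : ℕ} {X : Ω → Fin n → ℝ} (hX : ∀ i, MemLp (fun ω => X ω i) 2 μ)
    (hX0 : ∀ i, ∫ ω, X ω i ∂μ = 0) {V : Matrix (Fin n) (Fin n) ℝ}
    (hV : ∀ i j, ∫ ω, X ω i * X ω j ∂μ = V i j) (G : Matrix (Fin n) (Fin n) ℝ)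
    (v : Fin n → ℝ) :
    Integrable (fun ω => (v + X ω) ⬝ᵥ (G *ᵥ (v + X ω))) μ ∧
      ∫ ω, (v + X ω) ⬝ᵥ (G *ᵥ (v + X ω)) ∂μ = v ⬝ᵥ (G *ᵥ v) + (V * G).trace := by
  have hexp : ∀ y : Fin n → ℝ, y ⬝ᵥ (G *ᵥ y) = ∑ i, ∑ j, G i j * (y i * y j) := fun y => by
    simp only [dotProduct, mulVec, Finset.mul_sum]
    exact Finset.sum_congr rfl fun i _ => Finset.sum_congr rfl fun j _ => by ring
  have hmul : ∀ i j, Integrable (fun ω => X ω i * X ω j) μ := fun i j =>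
    (hX i).integrable_mul (hX j)
  have hint : ∀ i, Integrable (fun ω => X ω i) μ := fun i => (hX i).integrable one_le_two
  have hsplit : ∀ i j, (fun ω => (v + X ω) i * (v + X ω) j)
      = fun ω => v i * v j + v i * X ω j + v j * X ω i + X ω i * X ω j := fun i j => by
    funext ω
    simp only [Pi.add_apply]
    ring
  have h3 : ∀ i j, Integrable (fun ω => v i * v j + v i * X ω j + v j * X ω i) μ := fun i j =>
    ((integrable_const _).add ((hint j).const_mul _)).add ((hint i).const_mul _)
  have h4 : ∀ i j, Integrable (fun ω => (v + X ω) i * (v + X ω) j) μ := fun i j => by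
    rw [hsplit]
    exact (h3 i j).add (hmul i j)
  have h5 : ∀ i j, ∫ ω, (v + X ω) i * (v + X ω) j ∂μ = v i * v j + V i j := fun i j => by
    have h2 : Integrable (fun ω => v i * v j + v i * X ω j) μ :=
      (integrable_const _).add ((hint j).const_mul _)
    rw [hsplit, integral_add (h3 i j) (hmul i j), integral_add h2 ((hint i).const_mul _),
      integral_add (integrable_const _) ((hint j).const_mul _), integral_const_mul (v i) (fun ω => X ω j),
      integral_const_mul (v j) (fun ω => X ω i), hX0, hX0, hV]
    simp
  simp only [hexp]
  have h6 : ∀ i, Integrable (fun ω => ∑ j, G i j * ((v + X ω) i * (v + X ω) j)) μ := fun i =>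
    integrable_finsetSum _ fun j _ => (h4 i j).const_mul _
  refine ⟨integrable_finsetSum _ fun i _ => h6 i, ?_⟩
  rw [integral_finsetSum _ fun i _ => h6 i]
  have hVs : ∀ i j, V i j = V j i := fun i j => by
    rw [← hV, ← hV]
    simp only [mul_comm]
  have htr : (V * G).trace = ∑ i, ∑ j, G i j * V i j := by
    simp only [trace, diag_apply, mul_apply]
    rw [Finset.sum_comm]
    exact Finset.sum_congr rfl fun i _ => Finset.sum_congr rfl fun j _ => by
      rw [hVs i j, mul_comm]
  rw [htr, ← Finset.sum_add_distrib]
  refine Finset.sum_congr rfl fun i _ => ?_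
  rw [integral_finsetSum _ fun j _ => (h4 i j).const_mul _, ← Finset.sum_add_distrib]
  exact Finset.sum_congr rfl fun j _ => by rw [integral_const_mul, h5, mul_add]

end Moments

namespace IsGaussianWhiteNoise

variable {Ω : Type*} [MeasurableSpace Ω] {μ : Measure Ω} [IsProbabilityMeasure μ] {s : ℕ}
  {w : ℕ → Ω → Fin s → ℝ} {S : Matrix (Fin s) (Fin s) ℝ} (hw : IsGaussianWhiteNoise w S μ)
include hw

omit [IsProbabilityMeasure μ] in
theorem memLp (t : ℕ) (i : Fin s) : MemLp (fun ω => w t ω i) 2 μ :=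
  ((hw.gaussian t).map_fun (ContinuousLinearMap.proj (R := ℝ) (φ := fun _ : Fin s => ℝ) i)).memLp_two

omit [IsProbabilityMeasure μ] in
theorem cross_moment {a b : ℕ} (hab : a ≠ b) (i j : Fin s) :
    ∫ ω, w a ω i * w b ω j ∂μ = 0 := by
  have h : IndepFun (fun ω => w a ω i) (fun ω => w b ω j) μ :=
    (hw.indep.indepFun hab).comp (measurable_pi_apply i) (measurable_pi_apply j)
  rw [h.integral_fun_mul_eq_mul_integral (hw.memLp a i).1 (hw.memLp b j).1, hw.mean_zero,
    zero_mul]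

end IsGaussianWhiteNoise

namespace LQGData

variable {q p s m : ℕ} {D : LQGData q p s}
  {Ω : Type*} [MeasurableSpace Ω] {μ : Measure Ω} [IsProbabilityMeasure μ]
  {w : ℕ → Ω → Fin s → ℝ} {S : Matrix (Fin s) (Fin s) ℝ}

variable (D w) in
/-- The estimation error after `t` steps without measurement. -/
def err (t : ℕ) (ω : Ω) : Fin q → ℝ := D.openLoop 0 (fun k => w k ω) 0 t

omit [MeasurableSpace Ω] in
theorem err_zero (ω : Ω) : D.err w 0 ω = 0 := rfl

omit [MeasurableSpace Ω] in
theorem err_succ (t : ℕ) (ω : Ω) : D.err w (t + 1) ω = D.A *ᵥ D.err w t ω + D.C *ᵥ w t ω := by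
  simp [err, openLoop, step]

section
variable (hw : IsGaussianWhiteNoise w S μ)
include hw

omit [IsProbabilityMeasure μ] in
theorem err_memLp (t : ℕ) (i : Fin q) : MemLp (fun ω => D.err w t ω i) 2 μ := by
  induction t generalizing i with
  | zero => simp [err_zero]
  | succ t ih =>
    simp only [err_succ, Pi.add_apply, mulVec, dotProduct]
    exact (memLp_finsetSum _ fun j _ => (ih j).const_mul _).add
      (memLp_finsetSum _ fun j _ => (hw.memLp t j).const_mul _)

omit [IsProbabilityMeasure μ] in
-- One recursion serves three purposes: `Z = 1` gives the mean, `Z` a noise component gives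
-- orthogonality to present and later noise, and `Z` an error component gives the covariance
-- recursion.
theorem integral_err_succ_mul {Z : Ω → ℝ} (hZ : MemLp Z 2 μ) (t : ℕ) (i : Fin q) :
    ∫ ω, D.err w (t + 1) ω i * Z ω ∂μ
      = ∑ l, D.A i l * ∫ ω, D.err w t ω l * Z ω ∂μ + ∑ k, D.C i k * ∫ ω, w t ω k * Z ω ∂μ := by
  have h1 : ∀ l, Integrable (fun ω => D.A i l * (D.err w t ω l * Z ω)) μ := fun l =>
    ((err_memLp hw t l).integrable_mul hZ).const_mul _
  have h2 : ∀ k, Integrable (fun ω => D.C i k * (w t ω k * Z ω)) μ := fun k =>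
    ((hw.memLp t k).integrable_mul hZ).const_mul _
  simp only [err_succ, Pi.add_apply, mulVec, dotProduct, add_mul, Finset.sum_mul, mul_assoc]
  rw [integral_add (integrable_finsetSum _ fun l _ => h1 l)
    (integrable_finsetSum _ fun k _ => h2 k), integral_finsetSum _ fun l _ => h1 l,
    integral_finsetSum _ fun k _ => h2 k]
  simp only [integral_const_mul]

theorem integral_err (t : ℕ) (i : Fin q) : ∫ ω, D.err w t ω i ∂μ = 0 := by
  induction t generalizing i with
  | zero => simp [err_zero]
  | succ t ih =>
    have := integral_err_succ_mul (D := D) hw (memLp_const (1 : ℝ)) t i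
    simpa [ih, hw.mean_zero] using this

omit [IsProbabilityMeasure μ] in
theorem integral_err_mul_noise (t k : ℕ) (htk : t ≤ k) (i : Fin q) (j : Fin s) :
    ∫ ω, D.err w t ω i * w k ω j ∂μ = 0 := by
  induction t generalizing i with
  | zero => simp [err_zero]
  | succ t ih =>
    rw [integral_err_succ_mul hw (hw.memLp k j)]
    simp [ih (by omega), hw.cross_moment (show t ≠ k by omega)]

omit [IsProbabilityMeasure μ] in
theorem integral_err_mul_err (t : ℕ) (i j : Fin q) :
    ∫ ω, D.err w t ω i * D.err w t ω j ∂μ = D.errCov S t i j := by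
  induction t generalizing i j with
  | zero => simp [err_zero, errCov]
  | succ t ih =>
    have h1 : ∀ l, ∫ ω, D.err w t ω l * D.err w (t + 1) ω j ∂μ
        = ∑ l', D.A j l' * D.errCov S t l l' := fun l => by
      simp only [mul_comm (D.err w t _ l)]
      rw [integral_err_succ_mul hw (err_memLp hw t l)]
      simp only [mul_comm _ (D.err w t _ l), ih,
        integral_err_mul_noise hw t t le_rfl, mul_zero, Finset.sum_const_zero, add_zero]
    have h2 : ∀ k, ∫ ω, w t ω k * D.err w (t + 1) ω j ∂μ = ∑ k', D.C j k' * S k k' := fun k => by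
      simp only [mul_comm (w t _ k)]
      rw [integral_err_succ_mul hw (hw.memLp t k)]
      simp only [integral_err_mul_noise hw t t le_rfl, mul_zero, Finset.sum_const_zero, zero_add]
      simp only [mul_comm _ (w t _ k), hw.second_moment]
    rw [integral_err_succ_mul hw (err_memLp hw (t + 1) j)]
    simp only [h1, h2, errCov]
    rw [Matrix.add_apply, mul_apply, mul_apply]
    simp only [mul_apply, transpose_apply, Finset.mul_sum, Finset.sum_mul]
    congr 1
    · rw [Finset.sum_comm]
      exact Finset.sum_congr rfl fun l _ => Finset.sum_congr rfl fun l' _ => by ring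
    · rw [Finset.sum_comm]
      exact Finset.sum_congr rfl fun l _ => Finset.sum_congr rfl fun l' _ => by ring

omit [IsProbabilityMeasure μ] hw [MeasurableSpace Ω] in
theorem openLoop_eq_add_err (u : ℕ → Fin p → ℝ) (x : Fin q → ℝ) (t : ℕ) (ω : Ω) :
    D.openLoop u (fun k => w k ω) x t = D.openLoop u 0 x t + D.err w t ω :=
  D.openLoop_eq_add_noise u _ x t

/-- The matrices `errCov` are the covariance matrices of the state under open-loop controls. -/
theorem cov_openLoop (u : ℕ → Fin p → ℝ) (x : Fin q → ℝ) (t : ℕ) (i j : Fin q) :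
    cov[fun ω => D.openLoop u (fun k => w k ω) x t i,
        fun ω => D.openLoop u (fun k => w k ω) x t j; μ] = D.errCov S t i j := by
  have hmean : ∀ i, ∫ ω, D.openLoop u (fun k => w k ω) x t i ∂μ = D.openLoop u 0 x t i := fun i => by
    simp only [openLoop_eq_add_err, Pi.add_apply]
    rw [integral_add (integrable_const _) ((err_memLp hw t i).integrable one_le_two),
      integral_err hw]
    simp
  rw [covariance]
  simp only [hmean]
  simp only [openLoop_eq_add_err, Pi.add_apply, add_sub_cancel_left]
  exact integral_err_mul_err hw t i j

/-- The expected value of a quadratic form of the state under open-loop controls. -/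
theorem integral_quadForm_openLoop (G : Matrix (Fin q) (Fin q) ℝ) (u : ℕ → Fin p → ℝ)
    (x : Fin q → ℝ) (t : ℕ) :
    Integrable (fun ω => D.openLoop u (fun k => w k ω) x t
        ⬝ᵥ (G *ᵥ D.openLoop u (fun k => w k ω) x t)) μ ∧
      ∫ ω, D.openLoop u (fun k => w k ω) x t ⬝ᵥ (G *ᵥ D.openLoop u (fun k => w k ω) x t) ∂μ
        = D.openLoop u 0 x t ⬝ᵥ (G *ᵥ D.openLoop u 0 x t) + (D.errCov S t * G).trace := by
  simp only [openLoop_eq_add_err]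
  exact integral_quadForm (err_memLp hw t) (integral_err hw t) (integral_err_mul_err hw t) G _

/-- The trace is the expectation of a nonnegative form at the error. -/
theorem trace_errCov_mul_nonneg (t : ℕ) {G : Matrix (Fin q) (Fin q) ℝ} (hG : G.PosSemidef) :
    0 ≤ (D.errCov S t * G).trace := by
  have h := (integral_quadForm_openLoop (D := D) hw G 0 0 t).2
  rw [openLoop_zero_zero, mulVec_zero, zero_dotProduct, zero_add] at h
  rw [← h]
  exact integral_nonneg fun ω => (posSemidef_real_iff.mp hG).2 _

theorem trace_noise_nonneg {P : Matrix (Fin q) (Fin q) ℝ} (hP : P.PosSemidef) :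
    0 ≤ (S * D.Cᵀ * P * D.C).trace := by
  have hG : (D.Cᵀ * P * D.C).PosSemidef := by
    simpa [conjTranspose_eq_transpose_of_trivial] using hP.conjTranspose_mul_mul_same D.C
  have h := (integral_quadForm (hw.memLp 0) (hw.mean_zero 0) (hw.second_moment 0)
    (D.Cᵀ * P * D.C) 0).2
  rw [mulVec_zero, zero_dotProduct, zero_add] at h
  rw [Matrix.mul_assoc, Matrix.mul_assoc, ← Matrix.mul_assoc D.Cᵀ, ← h]
  exact integral_nonneg fun ω => (posSemidef_real_iff.mp hG).2 _

end

/-- The error terms of the cost over one period, rewritten with the Riccati equation. -/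
theorem trace_telescope {P : Matrix (Fin q) (Fin q) ℝ} (hric : D.Riccati P) (T : ℕ) :
    ∑ t ∈ Finset.range T, D.β ^ t * (D.errCov S t * D.Q).trace
        + D.β ^ T * (D.errCov S T * P).trace
      = ∑ t ∈ Finset.range T, D.β ^ t * (D.errCov S t * D.phi P).trace
        + ∑ t ∈ Finset.Icc 1 T, D.β ^ t * (S * D.Cᵀ * P * D.C).trace := by
  induction T with
  | zero => simp [errCov]
  | succ T ih =>
    have h1 : (D.errCov S (T + 1) * P).trace
        = (D.errCov S T * (D.Aᵀ * P * D.A)).trace + (S * D.Cᵀ * P * D.C).trace := by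
      rw [errCov, Matrix.add_mul, trace_add, Matrix.mul_assoc, Matrix.mul_assoc, trace_mul_comm,
        Matrix.mul_assoc D.C, Matrix.mul_assoc D.C, trace_mul_comm D.C]
      simp only [Matrix.mul_assoc]
    -- The Riccati equation enters here, traded against the growth of the covariance in `h1`.
    have h2 : (D.errCov S T * P).trace = (D.errCov S T * D.Q).trace
        + D.β * (D.errCov S T * (D.Aᵀ * P * D.A)).trace - (D.errCov S T * D.phi P).trace := by
      conv_lhs => rw [riccati_iff.mp hric, ricc]
      rw [Matrix.mul_sub, Matrix.mul_add, trace_sub, trace_add, Matrix.mul_smul, trace_smul,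
        smul_eq_mul]
    rw [Finset.sum_range_succ, Finset.sum_range_succ, Finset.sum_Icc_succ_top (by omega), h1]
    linear_combination ih - D.β ^ T * h2

section
variable (hw : IsGaussianWhiteNoise w S μ) (hQ : D.Q.PosSemidef) (hR : D.R.PosDef)
  (hβ : 0 ≤ D.β) (hO : 0 ≤ D.O) {P : Matrix (Fin q) (Fin q) ℝ} (hP : P.PosSemidef)
  (hric : D.Riccati P)

theorem measurable_openLoop (u : ℕ → Fin p → ℝ) (x : Fin q → ℝ) (t : ℕ) :
    Measurable fun v : ℕ → Fin s → ℝ => D.openLoop u v x t := by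
  induction t with
  | zero => exact measurable_const
  | succ t ih =>
    simp only [openLoop, step]
    have h1 : Measurable fun y : Fin q → ℝ => D.A *ᵥ y :=
      (Continuous.matrix_mulVec continuous_const continuous_id).measurable
    have h2 : Measurable fun y : Fin s → ℝ => D.C *ᵥ y :=
      (Continuous.matrix_mulVec continuous_const continuous_id).measurable
    exact ((h1.comp ih).add measurable_const).add (h2.comp (measurable_pi_apply t))

include hw hQ hR hβ hO hP hric in
/-- The expected cost of one period of length `T` with the terminal cost `x'Px + r`. -/
theorem lintegral_period (u : ℕ → Fin p → ℝ) (x : Fin q → ℝ) (T : ℕ) {r : ℝ} (hr : 0 ≤ r) :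
    ∫⁻ ω, ((∑ t ∈ Finset.range T, ENNReal.ofReal (D.β ^ t *
          D.stageCost (D.openLoop u (fun j => w j ω) x t) (u t)))
        + ENNReal.ofReal (D.β ^ T) * ENNReal.ofReal
          (D.openLoop u (fun j => w j ω) x T ⬝ᵥ (P *ᵥ D.openLoop u (fun j => w j ω) x T) + r)
        + ENNReal.ofReal (D.β ^ T * D.O)) ∂μ
      = ENNReal.ofReal (x ⬝ᵥ (P *ᵥ x) + ∑ t ∈ Finset.range T, D.β ^ t *
          ((u t + D.gain P *ᵥ D.openLoop u 0 x t)
            ⬝ᵥ (D.gainDen P *ᵥ (u t + D.gain P *ᵥ D.openLoop u 0 x t)))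
        + D.bracket S P r T) := by
  have hβT : ∀ t, 0 ≤ D.β ^ t := fun t => pow_nonneg hβ t
  have hst : ∀ ω t, 0 ≤ D.β ^ t * D.stageCost (D.openLoop u (fun j => w j ω) x t) (u t) :=
    fun ω t => mul_nonneg (hβT t) (stageCost_nonneg hQ hR _ _)
  have hPn := (posSemidef_real_iff.mp hP).2
  have hMn := gainDen_posDef hR hβ hP
  have hI1 : ∀ t, Integrable (fun ω =>
      D.β ^ t * D.stageCost (D.openLoop u (fun j => w j ω) x t) (u t)) μ := fun t =>
    ((integral_quadForm_openLoop hw D.Q u x t).1.add (integrable_const _)).const_mul _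
  have hI2 : Integrable (fun ω => D.openLoop u (fun j => w j ω) x T
      ⬝ᵥ (P *ᵥ D.openLoop u (fun j => w j ω) x T) + r) μ :=
    (integral_quadForm_openLoop hw P u x T).1.add (integrable_const _)
  have hs1 : ∀ t, ∫ ω, D.β ^ t * D.stageCost (D.openLoop u (fun j => w j ω) x t) (u t) ∂μ
      = D.β ^ t * D.stageCost (D.openLoop u 0 x t) (u t)
        + D.β ^ t * (D.errCov S t * D.Q).trace := fun t => by
    obtain ⟨h1, h2⟩ := integral_quadForm_openLoop (D := D) hw D.Q u x t
    rw [integral_const_mul]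
    simp only [stageCost]
    rw [integral_add h1 (integrable_const _), h2]
    simp
    ring
  have hs2 : ∫ ω, (D.openLoop u (fun j => w j ω) x T
      ⬝ᵥ (P *ᵥ D.openLoop u (fun j => w j ω) x T) + r) ∂μ
      = D.openLoop u 0 x T ⬝ᵥ (P *ᵥ D.openLoop u 0 x T) + (D.errCov S T * P).trace + r := by
    obtain ⟨h1, h2⟩ := integral_quadForm_openLoop (D := D) hw P u x T
    rw [integral_add h1 (integrable_const _), h2]
    simp
  have hpt : ∀ ω, (∑ t ∈ Finset.range T, ENNReal.ofReal (D.β ^ t *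
          D.stageCost (D.openLoop u (fun j => w j ω) x t) (u t)))
        + ENNReal.ofReal (D.β ^ T) * ENNReal.ofReal
          (D.openLoop u (fun j => w j ω) x T ⬝ᵥ (P *ᵥ D.openLoop u (fun j => w j ω) x T) + r)
        + ENNReal.ofReal (D.β ^ T * D.O)
      = ENNReal.ofReal ((∑ t ∈ Finset.range T, D.β ^ t *
          D.stageCost (D.openLoop u (fun j => w j ω) x t) (u t)) + D.β ^ T *
          (D.openLoop u (fun j => w j ω) x T ⬝ᵥ (P *ᵥ D.openLoop u (fun j => w j ω) x T) + r)
        + D.β ^ T * D.O) := fun ω => by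
    have h1 := Finset.sum_nonneg fun t (_ : t ∈ Finset.range T) => hst ω t
    have h2 := mul_nonneg (hβT T) (add_nonneg (hPn (D.openLoop u (fun j => w j ω) x T)) hr)
    rw [ENNReal.ofReal_add (add_nonneg h1 h2) (mul_nonneg (hβT T) hO),
      ENNReal.ofReal_add h1 h2, ENNReal.ofReal_mul (hβT T) (q := _ + r),
      ENNReal.ofReal_sum_of_nonneg fun t _ => hst ω t]
  simp only [hpt]
  have hI3 := integrable_finsetSum (Finset.range T) fun t _ => hI1 t
  have hI4 := hI2.const_mul (D.β ^ T)
  have hI34 : Integrable (fun ω => (∑ t ∈ Finset.range T, D.β ^ t *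
          D.stageCost (D.openLoop u (fun j => w j ω) x t) (u t)) + D.β ^ T *
          (D.openLoop u (fun j => w j ω) x T
            ⬝ᵥ (P *ᵥ D.openLoop u (fun j => w j ω) x T) + r)) μ := hI3.add hI4
  have hI5 : Integrable (fun ω => (∑ t ∈ Finset.range T, D.β ^ t *
          D.stageCost (D.openLoop u (fun j => w j ω) x t) (u t)) + D.β ^ T *
          (D.openLoop u (fun j => w j ω) x T
            ⬝ᵥ (P *ᵥ D.openLoop u (fun j => w j ω) x T) + r) + D.β ^ T * D.O) μ :=
    hI34.add (integrable_const _)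
  rw [← ofReal_integral_eq_lintegral_ofReal hI5
    (Filter.Eventually.of_forall fun ω => add_nonneg (add_nonneg
      (Finset.sum_nonneg fun t _ => hst ω t) (mul_nonneg (hβT T) (add_nonneg (hPn _) hr)))
      (mul_nonneg (hβT T) hO))]
  congr 1
  -- The noiseless part is resummed by the Riccati telescope for trajectories, the error part by the
  -- one for traces.
  rw [integral_add hI34 (integrable_const _), integral_add hI3 hI4,
    integral_finsetSum _ fun t _ => hI1 t, integral_const_mul, hs2,
    ← noiseless_cost (posSemidef_real_iff.mp hP).1 hMn hric, bracket, ← trace_telescope hric]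
  simp only [hs1, Finset.sum_add_distrib, integral_const, probReal_univ, one_smul]
  ring

end

end LQGData

/-! ### Stationarity of the noise and renewal at a fixed time. -/

namespace IsGaussianWhiteNoise

variable {Ω : Type*} [MeasurableSpace Ω] {μ : Measure Ω} [IsProbabilityMeasure μ] {s : ℕ}
  {w : ℕ → Ω → Fin s → ℝ} {S : Matrix (Fin s) (Fin s) ℝ} (hw : IsGaussianWhiteNoise w S μ)
include hw

/-- A centred Gaussian law is determined by its second moments: the characteristic function at `L`
depends only on the variance of `L`, the trace of `S` against a rank-one matrix. -/
theorem map_eq (a b : ℕ) : μ.map (w a) = μ.map (w b) := by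
  have key : ∀ (t : ℕ) (L : StrongDual ℝ (Fin s → ℝ)),
      charFunDual (μ.map (w t)) L = Complex.exp (-(((S * vecMulVec (fun i => L (Pi.single i 1))
        (fun i => L (Pi.single i 1))).trace : ℝ) : ℂ) / 2) := by
    intro t L
    have := (hw.gaussian t).isGaussian_map
    have hL : ∀ v : Fin s → ℝ, L v = (fun i => L (Pi.single i 1)) ⬝ᵥ v := fun v => by
      conv_lhs => rw [pi_eq_sum_univ' v]
      simp only [map_sum, map_smul, smul_eq_mul, dotProduct]
      refine Finset.sum_congr rfl fun i _ => ?_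
      rw [mul_comm]
    have hmean : ∫ ω, L (w t ω) ∂μ = 0 := by
      rw [L.integral_comp_comm (hw.gaussian t).integrable]
      have : ∫ ω, w t ω ∂μ = 0 := by
        ext i
        rw [eval_integral fun i => (hw.memLp t i).integrable one_le_two, hw.mean_zero]
        rfl
      rw [this, map_zero]
    have hvar : Var[fun ω => L (w t ω); μ] = (S * vecMulVec (fun i => L (Pi.single i 1))
        (fun i => L (Pi.single i 1))).trace := by
      have h := (integral_quadForm (hw.memLp t) (hw.mean_zero t) (hw.second_moment t)
        (vecMulVec (fun i => L (Pi.single i 1)) (fun i => L (Pi.single i 1))) 0).2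
      rw [mulVec_zero, zero_dotProduct, zero_add] at h
      rw [variance_of_integral_eq_zero _ hmean, ← h]
      · refine integral_congr_ae (Filter.Eventually.of_forall fun ω => ?_)
        simp only [zero_add, hL (w t ω), vecMulVec_mulVec]
        simp [dotProduct_comm, sq]
      · exact (L.measurable.comp (hw.measurable t)).aemeasurable
    rw [(hw.gaussian t).charFunDual_map_eq_fun L, hmean, hvar]
    simp [neg_div]
  have ha := (hw.gaussian a).isGaussian_map
  have hb := (hw.gaussian b).isGaussian_map
  exact Measure.ext_of_charFunDual (funext fun L => by rw [key, key])

/-- The shifted noise has the law of the noise. -/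
theorem map_shift_eq (T : ℕ) :
    μ.map (fun ω j => w (T + j) ω) = μ.map (fun ω j => w j ω) := by
  rw [(hw.indep.precomp (add_right_injective T)).map_fun_eq_infinitePi_map
    fun i => hw.measurable _, hw.indep.map_fun_eq_infinitePi_map hw.measurable]
  congr 1
  funext i
  exact hw.map_eq _ _

omit [IsProbabilityMeasure μ] in
theorem measurable_path : Measurable fun ω j => w j ω := measurable_pi_iff.mpr hw.measurable

omit [IsProbabilityMeasure μ] in
/-- The noise from time `T` on is independent of the noise before time `T`. -/
theorem indepFun_past_future (T : ℕ) :
    IndepFun (fun ω (j : ℕ) => if j < T then w j ω else 0) (fun ω j => w (T + j) ω) μ := by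
  have h := indep_iSup_of_disjoint (fun k => (hw.measurable k).comap_le) hw.indep.iIndep
    (S := {k | k < T}) (T := {k | T ≤ k})
    (Set.disjoint_left.mpr fun k (h1 : k < T) (h2 : T ≤ k) => absurd h1 (not_lt.mpr h2))
  refine indep_of_indep_of_le_left (indep_of_indep_of_le_right h ?_) ?_
  · rw [← measurable_iff_comap_le]
    refine (@measurable_pi_iff _ _ _ (_) _ _).mpr fun j => ?_
    exact (comap_measurable (w (T + j))).mono
      (le_iSup₂ (f := fun k (_ : k ∈ {k | T ≤ k}) => MeasurableSpace.comap (w k) _) (T + j)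
        (Nat.le_add_right T j)) le_rfl
  · rw [← measurable_iff_comap_le]
    refine (@measurable_pi_iff _ _ _ (_) _ _).mpr fun j => ?_
    by_cases hj : j < T
    · simp only [hj, if_true]
      exact (comap_measurable (w j)).mono
        (le_iSup₂ (f := fun k (_ : k ∈ {k | k < T}) => MeasurableSpace.comap (w k) _) j hj) le_rfl
    · simp only [hj, if_false]
      exact @measurable_const _ _ (_) (_) _

end IsGaussianWhiteNoise

namespace LQGData

variable {q p s m : ℕ} {D : LQGData q p s}
  {Ω : Type*} [MeasurableSpace Ω] {μ : Measure Ω} [IsProbabilityMeasure μ]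
  {w : ℕ → Ω → Fin s → ℝ} {S : Matrix (Fin s) (Fin s) ℝ}

theorem openLoop_congr_noise (u : ℕ → Fin p → ℝ) {v v' : ℕ → Fin s → ℝ} (x : Fin q → ℝ) {t : ℕ}
    (h : ∀ j < t, v j = v' j) : D.openLoop u v x t = D.openLoop u v' x t := by
  induction t with
  | zero => rfl
  | succ t ih => rw [openLoop, openLoop, ih fun j hj => h j (by omega), h t (by omega)]

/-- The noise from time `T` on may be replaced by an independent copy of the noise. -/
theorem lintegral_renewal (hw : IsGaussianWhiteNoise w S μ)
    {f : (ℕ → Fin s → ℝ) → (Fin q → ℝ) → ℝ≥0∞} (hf : Measurable (Function.uncurry f))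
    (u : ℕ → Fin p → ℝ) (x : Fin q → ℝ) (T : ℕ) :
    ∫⁻ ω, f (fun j => w (T + j) ω) (D.openLoop u (fun j => w j ω) x T) ∂μ
      = ∫⁻ ω, ∫⁻ ω', f (fun j => w j ω') (D.openLoop u (fun j => w j ω) x T) ∂μ ∂μ := by
  -- The state at time `T` does not see the noise from `T` on, so it is a function of the truncated
  -- path and independent of the future.
  have hpast : ∀ ω, D.openLoop u (fun j => w j ω) x T
      = D.openLoop u (fun j => if j < T then w j ω else 0) x T := fun ω =>
    openLoop_congr_noise u x fun j hj => by simp [hj]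
  have hind : IndepFun (fun ω => D.openLoop u (fun j => w j ω) x T)
      (fun ω j => w (T + j) ω) μ := by
    simp only [hpast]
    exact (hw.indepFun_past_future T).comp (measurable_openLoop u x T) measurable_id
  have hX : Measurable fun ω => D.openLoop u (fun j => w j ω) x T :=
    (measurable_openLoop u x T).comp hw.measurable_path
  have hY : Measurable fun ω j => w (T + j) ω := measurable_pi_iff.mpr fun j => hw.measurable _
  have hg : Measurable fun z : (Fin q → ℝ) × (ℕ → Fin s → ℝ) => f z.2 z.1 :=
    hf.comp measurable_swap
  have h1 : ∫⁻ ω, f (fun j => w (T + j) ω) (D.openLoop u (fun j => w j ω) x T) ∂μ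
      = ∫⁻ z, f z.2 z.1 ∂(μ.map fun ω => (D.openLoop u (fun j => w j ω) x T,
          fun j => w (T + j) ω)) := (lintegral_map hg (hX.prodMk hY)).symm
  rw [h1, (indepFun_iff_map_prod_eq_prod_map_map hX.aemeasurable hY.aemeasurable).mp hind,
    hw.map_shift_eq]
  have := Measure.isProbabilityMeasure_map (μ := μ) hw.measurable_path.aemeasurable
  rw [lintegral_prod _ hg.aemeasurable, lintegral_map hg.lintegral_prod_right' hX]
  refine lintegral_congr fun ω => ?_
  exact lintegral_map (hg.comp measurable_prodMk_left) hw.measurable_path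

end LQGData

/-! ### Closed-loop paths and their restart at the first measurement. -/

namespace LQGData

variable {q p s m : ℕ} (D : LQGData q p s) (π : Strategy q p)

section Paths

variable (v : ℕ → Fin s → ℝ) (x : Fin q → ℝ)

/-- The state reached at the first measurement. -/
def firstMeas : Fin q → ℝ := D.openLoop (fun t => π.ctrl t x) v x (π.wait x)

theorem closedLoop_of_lt {t : ℕ} (ht : t < π.wait x) :
    D.closedLoop π v x t = (D.openLoop (fun t => π.ctrl t x) v x t, x, t) := by
  induction t with
  | zero => rfl
  | succ t ih => rw [closedLoop, ih (by omega)]; simp [ht.ne, openLoop]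

theorem closedLoop_wait :
    D.closedLoop π v x (π.wait x) = (D.firstMeas π v x, D.firstMeas π v x, 0) := by
  obtain ⟨n, hn⟩ : ∃ n, π.wait x = n + 1 := ⟨π.wait x - 1, by have := π.one_le_wait x; omega⟩
  rw [firstMeas, hn, closedLoop, closedLoop_of_lt D π v x (by omega)]
  simp [hn, openLoop]

/-- The closed loop restarts at the first measurement. -/
theorem closedLoop_wait_add (t : ℕ) :
    D.closedLoop π v x (π.wait x + t)
      = D.closedLoop π (fun j => v (π.wait x + j)) (D.firstMeas π v x) t := by
  induction t with
  | zero => rw [add_zero, closedLoop_wait]; rfl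
  | succ t ih => rw [← add_assoc, closedLoop, closedLoop, ih]

/-- Along a fixed path the realized controls are just a sequence, so pathwise estimates for
open-loop controls apply to strategies. -/
theorem state_eq_openLoop (t : ℕ) :
    D.state π v x t = D.openLoop (D.control π v x) v x t := by
  induction t with
  | zero => rfl
  | succ t ih =>
    have : D.state π v x (t + 1) = D.step (D.state π v x t) (D.control π v x t) (v t) := by
      rw [state, closedLoop]
      simp only [state, control]
      split <;> rfl
    rw [this, ih, openLoop]

theorem measTime_succ_eq (k : ℕ) :
    D.measTime π v x (k + 1) = π.wait x
      + D.measTime π (fun j => v (π.wait x + j)) (D.firstMeas π v x) k := by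
  induction k with
  | zero => simp [measTime, state, closedLoop]
  | succ k ih =>
    conv_lhs => rw [measTime]
    rw [ih, measTime, state, closedLoop_wait_add, add_assoc]
    rfl

/-- The discounted stage cost at time `t`. -/
noncomputable def stageTerm (t : ℕ) : ℝ≥0∞ :=
  ENNReal.ofReal (D.β ^ t * D.stageCost (D.state π v x t) (D.control π v x t))

/-- The discounted cost of measurement number `k + 1`. -/
noncomputable def measTerm (k : ℕ) : ℝ≥0∞ :=
  ENNReal.ofReal (D.β ^ D.measTime π v x (k + 1) * D.O)

variable {D}

theorem stageTerm_of_lt {t : ℕ} (ht : t < π.wait x) :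
    D.stageTerm π v x t = ENNReal.ofReal (D.β ^ t *
      D.stageCost (D.openLoop (fun t => π.ctrl t x) v x t) (π.ctrl t x)) := by
  simp only [stageTerm, state, control, closedLoop_of_lt D π v x ht]

theorem stageTerm_wait_add (hβ : 0 ≤ D.β) (t : ℕ) :
    D.stageTerm π v x (π.wait x + t) = ENNReal.ofReal (D.β ^ π.wait x) *
      D.stageTerm π (fun j => v (π.wait x + j)) (D.firstMeas π v x) t := by
  simp only [stageTerm, state, control, closedLoop_wait_add]
  rw [← ENNReal.ofReal_mul (pow_nonneg hβ _), ← mul_assoc, ← pow_add]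

theorem measTerm_zero : D.measTerm π v x 0 = ENNReal.ofReal (D.β ^ π.wait x * D.O) := by
  rw [measTerm, measTime_succ_eq, measTime, add_zero]

theorem measTerm_succ (hβ : 0 ≤ D.β) (k : ℕ) :
    D.measTerm π v x (k + 1) = ENNReal.ofReal (D.β ^ π.wait x) *
      D.measTerm π (fun j => v (π.wait x + j)) (D.firstMeas π v x) k := by
  rw [measTerm, measTime_succ_eq, measTerm, pow_add, mul_assoc,
    ENNReal.ofReal_mul (pow_nonneg hβ _)]

variable (D)

/-- The cost along a path up to and including the first measurement. -/
noncomputable def firstCost : ℝ≥0∞ :=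
  ∑ t ∈ Finset.range (π.wait x), ENNReal.ofReal (D.β ^ t *
      D.stageCost (D.openLoop (fun t => π.ctrl t x) v x t) (π.ctrl t x))
    + ENNReal.ofReal (D.β ^ π.wait x * D.O)

/-- The cost along a path. -/
noncomputable def pathCost : ℝ≥0∞ := ∑' t, D.stageTerm π v x t + ∑' k, D.measTerm π v x k

/-- The cost along a path of `n` steps and `n` measurements. -/
noncomputable def truncCost (n : ℕ) : ℝ≥0∞ :=
  ∑ t ∈ Finset.range n, D.stageTerm π v x t + ∑ k ∈ Finset.range n, D.measTerm π v x k

/-- The stage costs along a path from time `n` on. -/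
noncomputable def tailCost (n : ℕ) : ℝ≥0∞ := ∑' t, D.stageTerm π v x (n + t)

variable {D}

theorem pathCost_eq (hβ : 0 ≤ D.β) :
    D.pathCost π v x = D.firstCost π v x + ENNReal.ofReal (D.β ^ π.wait x) *
      D.pathCost π (fun j => v (π.wait x + j)) (D.firstMeas π v x) := by
  have h1 : ∑' t, D.stageTerm π v x t
      = ∑ t ∈ Finset.range (π.wait x), D.stageTerm π v x t
        + ∑' t, D.stageTerm π v x (π.wait x + t) := by
    simp only [add_comm (π.wait x)]
    exact (ENNReal.summable.sum_add_tsum_nat_add' (k := π.wait x)).symm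
  have h2 : ∑' k, D.measTerm π v x k = D.measTerm π v x 0 + ∑' k, D.measTerm π v x (k + 1) := by
    simpa using (ENNReal.summable.sum_add_tsum_nat_add' (f := D.measTerm π v x) (k := 1)).symm
  rw [pathCost, h1, h2, firstCost, pathCost]
  simp only [stageTerm_wait_add π v x hβ, measTerm_succ π v x hβ, ENNReal.tsum_mul_left,
    measTerm_zero]
  rw [Finset.sum_congr rfl fun t ht => stageTerm_of_lt π v x (Finset.mem_range.mp ht)]
  ring

/-- The first period uses one measurement and at least one step, so `n + 1` steps fit into `wait x +
n`. -/
theorem truncCost_succ_le (hβ : 0 ≤ D.β) (n : ℕ) :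
    D.truncCost π v x (n + 1) ≤ D.firstCost π v x + ENNReal.ofReal (D.β ^ π.wait x) *
      D.truncCost π (fun j => v (π.wait x + j)) (D.firstMeas π v x) n := by
  have h1 : ∑ t ∈ Finset.range (n + 1), D.stageTerm π v x t
      ≤ ∑ t ∈ Finset.range (π.wait x + n), D.stageTerm π v x t :=
    Finset.sum_le_sum_of_subset (Finset.range_subset_range.mpr
      (by have := π.one_le_wait x; omega))
  rw [truncCost, Finset.sum_range_succ' (D.measTerm π v x)]
  refine (add_le_add_left h1 _).trans_eq ?_
  rw [Finset.sum_range_add, truncCost, firstCost]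
  simp only [stageTerm_wait_add π v x hβ, measTerm_succ π v x hβ, ← Finset.mul_sum,
    measTerm_zero]
  rw [Finset.sum_congr rfl fun t ht => stageTerm_of_lt π v x (Finset.mem_range.mp ht)]
  ring

theorem truncCost_mono : Monotone (D.truncCost π v x) := fun _ _ hab =>
  add_le_add (Finset.sum_le_sum_of_subset (Finset.range_subset_range.mpr hab))
    (Finset.sum_le_sum_of_subset (Finset.range_subset_range.mpr hab))

theorem pathCost_eq_iSup : D.pathCost π v x = ⨆ n, D.truncCost π v x n := by
  rw [pathCost, ENNReal.tsum_eq_iSup_nat, ENNReal.tsum_eq_iSup_nat,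
    ENNReal.iSup_add_iSup_of_monotone]
  · rfl
  · exact fun a b hab => Finset.sum_le_sum_of_subset (Finset.range_subset_range.mpr hab)
  · exact fun a b hab => Finset.sum_le_sum_of_subset (Finset.range_subset_range.mpr hab)

/-- Time `n` after the restart is time `wait x + n ≥ n + 1` of the original path. -/
theorem mul_tailCost_le (hβ : 0 ≤ D.β) (n : ℕ) :
    ENNReal.ofReal (D.β ^ π.wait x) *
      D.tailCost π (fun j => v (π.wait x + j)) (D.firstMeas π v x) n
      ≤ D.tailCost π v x (n + 1) := by
  rw [tailCost, tailCost, ← ENNReal.tsum_mul_left]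
  simp only [← stageTerm_wait_add π v x hβ]
  have h := π.one_le_wait x
  have hinj : Function.Injective fun t : ℕ => π.wait x - 1 + t := add_right_injective _
  refine le_trans (le_of_eq ?_)
    (ENNReal.tsum_comp_le_tsum_of_injective hinj fun t => D.stageTerm π v x (n + 1 + t))
  refine tsum_congr fun t => ?_
  congr 1
  omega

end Paths

section Measurability

theorem measurable_stageCost :
    Measurable fun z : (Fin q → ℝ) × (Fin p → ℝ) => D.stageCost z.1 z.2 := by
  refine Continuous.measurable ?_
  unfold stageCost
  exact (continuous_fst.dotProduct (continuous_const.matrix_mulVec continuous_fst)).add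
    (continuous_snd.dotProduct (continuous_const.matrix_mulVec continuous_snd))

theorem measurable_step :
    Measurable fun z : (Fin q → ℝ) × (Fin p → ℝ) × (Fin s → ℝ) => D.step z.1 z.2.1 z.2.2 := by
  refine Continuous.measurable ?_
  unfold step
  exact ((continuous_const.matrix_mulVec continuous_fst).add
    (continuous_const.matrix_mulVec (continuous_fst.comp continuous_snd))).add
    (continuous_const.matrix_mulVec (continuous_snd.comp continuous_snd))

theorem measurable_ctrl_uncurry :
    Measurable fun z : ℕ × (Fin q → ℝ) => π.ctrl z.1 z.2 :=
  measurable_from_prod_countable_right fun k => π.measurable_ctrl k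

theorem measurable_closedLoop (t : ℕ) :
    Measurable fun z : (ℕ → Fin s → ℝ) × (Fin q → ℝ) => D.closedLoop π z.1 z.2 t := by
  induction t with
  | zero => exact measurable_snd.prodMk (measurable_snd.prodMk measurable_const)
  | succ t ih =>
    have hx := ih.fst
    have hy := ih.snd.fst
    have hk := ih.snd.snd
    have hu := (measurable_ctrl_uncurry π).comp (hk.prodMk hy)
    have hv : Measurable fun z : (ℕ → Fin s → ℝ) × (Fin q → ℝ) => z.1 t :=
      (measurable_pi_apply t).comp measurable_fst
    have hn := (measurable_step D).comp (hx.prodMk (hu.prodMk hv))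
    simp only [closedLoop]
    refine Measurable.ite (measurableSet_eq_fun (hk.add_const 1) (π.measurable_wait.comp hy))
      (hn.prodMk (hn.prodMk measurable_const)) (hn.prodMk (hy.prodMk (hk.add_const 1)))

theorem measurable_stageTerm (t : ℕ) :
    Measurable fun z : (ℕ → Fin s → ℝ) × (Fin q → ℝ) => D.stageTerm π z.1 z.2 t := by
  have h := D.measurable_closedLoop π t
  exact (((measurable_stageCost D).comp (h.fst.prodMk
    ((measurable_ctrl_uncurry π).comp (h.snd.snd.prodMk h.snd.fst)))).const_mul _).ennreal_ofReal

theorem measurable_measTime (k : ℕ) :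
    Measurable fun z : (ℕ → Fin s → ℝ) × (Fin q → ℝ) => D.measTime π z.1 z.2 k := by
  induction k with
  | zero => exact measurable_const
  | succ k ih =>
    have h : Measurable fun y : ℕ × (ℕ → Fin s → ℝ) × (Fin q → ℝ) =>
        D.state π y.2.1 y.2.2 y.1 :=
      measurable_from_prod_countable_right fun t => (D.measurable_closedLoop π t).fst
    exact ih.add (π.measurable_wait.comp (h.comp (ih.prodMk measurable_id)))

theorem measurable_measTerm (k : ℕ) :
    Measurable fun z : (ℕ → Fin s → ℝ) × (Fin q → ℝ) => D.measTerm π z.1 z.2 k := by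
  have h : Measurable fun n : ℕ => ENNReal.ofReal (D.β ^ n * D.O) := measurable_from_top
  exact h.comp (D.measurable_measTime π (k + 1))

theorem measurable_pathCost :
    Measurable fun z : (ℕ → Fin s → ℝ) × (Fin q → ℝ) => D.pathCost π z.1 z.2 :=
  (Measurable.tsum fun t => D.measurable_stageTerm π t).add
    (Measurable.tsum fun k => D.measurable_measTerm π k)

theorem measurable_truncCost (n : ℕ) :
    Measurable fun z : (ℕ → Fin s → ℝ) × (Fin q → ℝ) => D.truncCost π z.1 z.2 n :=
  (Finset.measurable_fun_sum _ fun t _ => D.measurable_stageTerm π t).add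
    (Finset.measurable_fun_sum _ fun k _ => D.measurable_measTerm π k)

theorem measurable_tailCost (n : ℕ) :
    Measurable fun z : (ℕ → Fin s → ℝ) × (Fin q → ℝ) => D.tailCost π z.1 z.2 n :=
  Measurable.tsum fun t => D.measurable_stageTerm π (n + t)

theorem measurable_firstCost (x : Fin q → ℝ) :
    Measurable fun v : ℕ → Fin s → ℝ => D.firstCost π v x :=
  (Finset.measurable_fun_sum _ fun t _ => (((measurable_stageCost D).comp
    ((measurable_openLoop _ x t).prodMk measurable_const)).const_mul _).ennreal_ofReal).add
    measurable_const

end Measurability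

/-! ### The period operator and renewal inequalities. -/

section Expectations

variable {Ω : Type*} [MeasurableSpace Ω] (μ : Measure Ω) [IsProbabilityMeasure μ]
  (w : ℕ → Ω → Fin s → ℝ) {S : Matrix (Fin s) (Fin s) ℝ}

/-- The expectation of the cost to the first measurement and a discounted cost-to-go `f`. -/
noncomputable def periodOp (f : (Fin q → ℝ) → ℝ≥0∞) (x : Fin q → ℝ) : ℝ≥0∞ :=
  ∫⁻ ω, (D.firstCost π (fun j => w j ω) x
    + ENNReal.ofReal (D.β ^ π.wait x) * f (D.firstMeas π (fun j => w j ω) x)) ∂μ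

omit [IsProbabilityMeasure μ] in
theorem periodOp_mono {f g : (Fin q → ℝ) → ℝ≥0∞} (h : ∀ x, f x ≤ g x) (x : Fin q → ℝ) :
    D.periodOp π μ w f x ≤ D.periodOp π μ w g x :=
  lintegral_mono fun ω => by gcongr; exact h _

variable {D μ w}

omit [IsProbabilityMeasure μ] in
theorem cost_eq (x : Fin q → ℝ) :
    D.cost μ w π x = ∫⁻ ω, D.pathCost π (fun j => w j ω) x ∂μ := rfl

variable (hw : IsGaussianWhiteNoise w S μ)
include hw

theorem measurable_lintegral_path {f : (ℕ → Fin s → ℝ) → (Fin q → ℝ) → ℝ≥0∞}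
    (hf : Measurable (Function.uncurry f)) :
    Measurable fun x => ∫⁻ ω, f (fun j => w j ω) x ∂μ := by
  have h : Measurable fun z : (Fin q → ℝ) × Ω => f (fun j => w j z.2) z.1 :=
    hf.comp ((hw.measurable_path.comp measurable_snd).prodMk measurable_fst)
  exact h.lintegral_prod_right'

omit [IsProbabilityMeasure μ] in
theorem measurable_path_apply {f : (ℕ → Fin s → ℝ) → (Fin q → ℝ) → ℝ≥0∞}
    (hf : Measurable (Function.uncurry f)) (x : Fin q → ℝ) :
    Measurable fun ω => f (fun j => w j ω) x :=
  (hf.comp measurable_prodMk_right).comp hw.measurable_path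

/-- The expected cost-to-go averages over fresh noise, and renewal allows the shifted noise of the
same path instead. Pathwise identities thus become statements about `periodOp`. -/
theorem periodOp_lintegral {f : (ℕ → Fin s → ℝ) → (Fin q → ℝ) → ℝ≥0∞}
    (hf : Measurable (Function.uncurry f)) (x : Fin q → ℝ) :
    D.periodOp π μ w (fun y => ∫⁻ ω, f (fun j => w j ω) y ∂μ) x
      = ∫⁻ ω, (D.firstCost π (fun j => w j ω) x + ENNReal.ofReal (D.β ^ π.wait x) *
          f (fun j => w (π.wait x + j) ω) (D.firstMeas π (fun j => w j ω) x)) ∂μ := by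
  have h1 : Measurable fun ω => D.firstCost π (fun j => w j ω) x :=
    (D.measurable_firstCost π x).comp hw.measurable_path
  rw [periodOp, lintegral_add_left h1, lintegral_add_left h1,
    lintegral_const_mul' _ _ ENNReal.ofReal_ne_top,
    lintegral_const_mul' _ _ ENNReal.ofReal_ne_top]
  congr 2
  exact (lintegral_renewal hw hf _ x _).symm

/-- The cost of a strategy satisfies the renewal equation at the first measurement. -/
theorem cost_eq_periodOp (hβ : 0 ≤ D.β) (x : Fin q → ℝ) :
    D.cost μ w π x = D.periodOp π μ w (D.cost μ w π) x := by
  have hc : D.cost μ w π = fun y => ∫⁻ ω, D.pathCost π (fun j => w j ω) y ∂μ :=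
    funext fun y => cost_eq π y
  rw [hc, periodOp_lintegral π hw (f := fun v y => D.pathCost π v y) (D.measurable_pathCost π)]
  exact lintegral_congr fun ω => pathCost_eq π (fun j => w j ω) x hβ

theorem lintegral_truncCost_succ_le (hβ : 0 ≤ D.β) (n : ℕ) (x : Fin q → ℝ) :
    ∫⁻ ω, D.truncCost π (fun j => w j ω) x (n + 1) ∂μ
      ≤ D.periodOp π μ w (fun y => ∫⁻ ω, D.truncCost π (fun j => w j ω) y n ∂μ) x := by
  have h := periodOp_lintegral (D := D) π hw (f := fun v y => D.truncCost π v y n)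
    (D.measurable_truncCost π n) x
  rw [h]
  refine lintegral_mono fun ω => ?_
  exact truncCost_succ_le π (fun j => w j ω) x hβ n

theorem lintegral_tailCost_firstMeas_le (hβ : 0 ≤ D.β) (n : ℕ) (x : Fin q → ℝ) :
    ENNReal.ofReal (D.β ^ π.wait x) * ∫⁻ ω, ∫⁻ ω', D.tailCost π (fun j => w j ω')
        (D.firstMeas π (fun j => w j ω) x) n ∂μ ∂μ
      ≤ ∫⁻ ω, D.tailCost π (fun j => w j ω) x (n + 1) ∂μ := by
  have h := lintegral_renewal (D := D) hw (f := fun v y => D.tailCost π v y n)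
    (D.measurable_tailCost π n) (fun t => π.ctrl t x) x (π.wait x)
  simp only [firstMeas]
  rw [← h, ← lintegral_const_mul' _ _ ENNReal.ofReal_ne_top]
  exact lintegral_mono fun ω => mul_tailCost_le π (fun j => w j ω) x hβ n

/-- A strategy costs at most `f` if `f` satisfies the renewal inequality. -/
theorem cost_le_of_periodOp_le (hβ : 0 ≤ D.β) {f : (Fin q → ℝ) → ℝ≥0∞}
    (hf : ∀ x, D.periodOp π μ w f x ≤ f x) (x : Fin q → ℝ) : D.cost μ w π x ≤ f x := by
  -- The truncated costs start from `0`, so iteration stays below `f`. Monotone convergence then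
  -- removes the truncation; `f` need be neither finite nor measurable.
  have h1 : ∀ n x, ∫⁻ ω, D.truncCost π (fun j => w j ω) x n ∂μ ≤ f x := by
    intro n
    induction n with
    | zero => intro x; simp [truncCost]
    | succ n ih =>
      exact fun x => (lintegral_truncCost_succ_le π hw hβ n x).trans
        ((D.periodOp_mono π μ w ih x).trans (hf x))
  have hpath : ∀ ω, D.pathCost π (fun j => w j ω) x
      = ⨆ n, D.truncCost π (fun j => w j ω) x n := fun ω => pathCost_eq_iSup π (fun j => w j ω) x
  have hmeas : ∀ n, Measurable fun ω => D.truncCost π (fun j => w j ω) x n := fun n =>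
    measurable_path_apply hw (f := fun v y => D.truncCost π v y n) (D.measurable_truncCost π n) x
  have hmono : Monotone fun n ω => D.truncCost π (fun j => w j ω) x n := fun a b hab ω =>
    truncCost_mono π (fun j => w j ω) x hab
  rw [cost_eq, lintegral_congr hpath, lintegral_iSup hmeas hmono]
  exact iSup_le fun n => h1 n x

end Expectations

end LQGData

/-! ### The scalar fixed-point equation. -/

/-- The scalar fixed-point equation characterizes the optimal average over constant periods. -/
theorem isGLB_bracket_iff {β O r : ℝ} (hβ0 : 0 < β) (hβ1 : β < 1) (g : ℕ → ℝ) :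
    IsGLB {c : ℝ | ∃ T : ℕ, 1 ≤ T ∧ c = g T + β ^ T * (r + O)} r ↔
      IsGLB {c : ℝ | ∃ T : ℕ, 1 ≤ T ∧ c = (g T + β ^ T * O) / (1 - β ^ T)} r := by
  have hpow : ∀ T : ℕ, 1 ≤ T → β ^ T ≤ β := fun T hT =>
    (pow_le_pow_of_le_one hβ0.le hβ1.le hT).trans_eq (pow_one β)
  have hpos : ∀ T : ℕ, 0 < β ^ T := fun T => pow_pos hβ0 T
  have key : ∀ T : ℕ, 1 ≤ T → g T + β ^ T * (r + O) - r
      = (1 - β ^ T) * ((g T + β ^ T * O) / (1 - β ^ T) - r) := fun T hT => by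
    have : (1 - β ^ T) ≠ 0 := by linarith [hpow T hT]
    field_simp
    ring
  constructor
  · rintro ⟨h1, h2⟩
    refine ⟨?_, fun b hb => ?_⟩
    · rintro _ ⟨T, hT, rfl⟩
      have h3 : 0 ≤ g T + β ^ T * (r + O) - r := sub_nonneg.mpr (h1 ⟨T, hT, rfl⟩)
      rw [key T hT] at h3
      exact sub_nonneg.mp (nonneg_of_mul_nonneg_right h3 (by linarith [hpow T hT]))
    · by_contra! hlt
      -- The gap `b - r` survives in the brackets, since `1 - β ^ T ≥ 1 - β` uniformly in `T`.
      have h3 : r + (1 - β) * (b - r) ≤ r := h2 (by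
        rintro _ ⟨T, hT, rfl⟩
        have h4 : b ≤ (g T + β ^ T * O) / (1 - β ^ T) := hb ⟨T, hT, rfl⟩
        have h5 := key T hT
        have h6 := hpow T hT
        nlinarith)
      nlinarith
  · rintro ⟨h1, h2⟩
    refine ⟨?_, fun b hb => h2 ?_⟩
    · rintro _ ⟨T, hT, rfl⟩
      have h3 : r ≤ (g T + β ^ T * O) / (1 - β ^ T) := h1 ⟨T, hT, rfl⟩
      have := mul_nonneg (show 0 ≤ 1 - β ^ T by linarith [hpow T hT]) (sub_nonneg.mpr h3)
      rw [← key T hT] at this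
      linarith
    -- The bracket is a convex combination of `r` and the quotient, with `r` the smaller, so a bound
    -- below the bracket is below the quotient.
    · rintro _ ⟨T, hT, rfl⟩
      have h3 : r ≤ (g T + β ^ T * O) / (1 - β ^ T) := h1 ⟨T, hT, rfl⟩
      have h4 : b ≤ g T + β ^ T * (r + O) := hb ⟨T, hT, rfl⟩
      have h5 := key T hT
      have h6 := hpos T
      nlinarith

namespace LQGData

variable {q p s m : ℕ} {D : LQGData q p s}

/-- The constant part of the cost of the strategy with constant waiting time `T`. -/
noncomputable def periodicOffset (D : LQGData q p s) (S : Matrix (Fin s) (Fin s) ℝ)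
    (P : Matrix (Fin q) (Fin q) ℝ) (T : ℕ) : ℝ :=
  D.bracket S P 0 T / (1 - D.β ^ T)

/-- At `r = -O` the last term of the bracket disappears, which isolates the part free of `r` and
`O`. -/
theorem bracket_eq (S : Matrix (Fin s) (Fin s) ℝ) (P : Matrix (Fin q) (Fin q) ℝ) (r : ℝ) (T : ℕ) :
    D.bracket S P r T = D.bracket S P (-D.O) T + D.β ^ T * (r + D.O) := by
  simp [bracket]

theorem fixedPoint_iff (hβ0 : 0 < D.β) (hβ1 : D.β < 1) (S : Matrix (Fin s) (Fin s) ℝ)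
    (P : Matrix (Fin q) (Fin q) ℝ) (r : ℝ) :
    D.FixedPoint S P r ↔ IsGLB {c : ℝ | ∃ T : ℕ, 1 ≤ T ∧ c = D.periodicOffset S P T} r := by
  have h := isGLB_bracket_iff (O := D.O) (r := r) hβ0 hβ1 (D.bracket S P (-D.O))
  simp only [← bracket_eq] at h
  rw [FixedPoint, h]
  simp only [periodicOffset, bracket_eq S P 0, zero_add]

theorem bracket_periodicOffset (hβ0 : 0 ≤ D.β) (hβ1 : D.β < 1) (S : Matrix (Fin s) (Fin s) ℝ)
    (P : Matrix (Fin q) (Fin q) ℝ) {T : ℕ} (hT : 1 ≤ T) :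
    D.bracket S P (D.periodicOffset S P T) T = D.periodicOffset S P T := by
  have h : 1 - D.β ^ T ≠ 0 := (sub_pos.mpr (pow_lt_one₀ hβ0 hβ1 (by omega))).ne'
  rw [bracket_eq, periodicOffset, bracket_eq S P 0]
  field_simp
  ring

/-! ### The value function and optimal waiting times. -/

section Value

variable {Ω : Type*} [MeasurableSpace Ω] {μ : Measure Ω} [IsProbabilityMeasure μ]
  {w : ℕ → Ω → Fin s → ℝ} {S : Matrix (Fin s) (Fin s) ℝ} (hw : IsGaussianWhiteNoise w S μ)
  {J : Matrix (Fin m) (Fin q) ℝ} (hQ : D.Q = Jᵀ * J) (hR : D.R.PosDef)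
  (hβ0 : 0 < D.β) (hβ1 : D.β < 1) (hO : 0 ≤ D.O) (hAJ : IsObservable D.A J)
  {P : Matrix (Fin q) (Fin q) ℝ} (hP : P.PosSemidef) (hric : D.Riccati P)

include hw hR hβ0 hβ1 hO hP in
theorem periodicOffset_nonneg {T : ℕ} (hT : 1 ≤ T) : 0 ≤ D.periodicOffset S P T := by
  have h : 0 ≤ 1 - D.β ^ T := (sub_pos.mpr (pow_lt_one₀ hβ0.le hβ1 (by omega))).le
  refine div_nonneg ?_ h
  refine add_nonneg (add_nonneg (Finset.sum_nonneg fun t _ => ?_)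
    (Finset.sum_nonneg fun t _ => ?_)) (by positivity)
  · exact mul_nonneg (by positivity) (trace_errCov_mul_nonneg hw t (phi_posSemidef hR hβ0.le hP))
  · exact mul_nonneg (by positivity) (trace_noise_nonneg hw hP)

include hw hQ hR hβ0 hO hP hric in
/-- The period operator on quadratic functions. -/
theorem periodOp_quadForm (π : Strategy q p) (x : Fin q → ℝ) {r : ℝ} (hr : 0 ≤ r) :
    D.periodOp π μ w (fun y => ENNReal.ofReal (y ⬝ᵥ (P *ᵥ y) + r)) x
      = ENNReal.ofReal (x ⬝ᵥ (P *ᵥ x) + ∑ t ∈ Finset.range (π.wait x), D.β ^ t *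
          ((π.ctrl t x + D.gain P *ᵥ D.openLoop (fun t => π.ctrl t x) 0 x t)
            ⬝ᵥ (D.gainDen P *ᵥ (π.ctrl t x
              + D.gain P *ᵥ D.openLoop (fun t => π.ctrl t x) 0 x t)))
        + D.bracket S P r (π.wait x)) := by
  rw [← lintegral_period hw (posSemidef_of_eq_transpose_mul hQ) hR hβ0.le hO hP hric
    (fun t => π.ctrl t x) x (π.wait x) hr, periodOp]
  refine lintegral_congr fun ω => ?_
  rw [firstCost, firstMeas]
  ring

include hw hQ hR hβ0 hAJ in
/-- Observability bounds quadratic functions by the expected stage costs. -/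
theorem exists_quadForm_le_tailCost (P : Matrix (Fin q) (Fin q) ℝ) (r : ℝ) :
    ∃ a b : ℝ≥0∞, a ≠ ∞ ∧ b ≠ ∞ ∧ ∀ (π : Strategy q p) (x : Fin q → ℝ),
      ENNReal.ofReal (x ⬝ᵥ (P *ᵥ x) + r)
        ≤ a * ∫⁻ ω, D.tailCost π (fun j => w j ω) x 0 ∂μ + b := by
  obtain ⟨c₁, hc₁, h₁⟩ := exists_quadForm_le P
  obtain ⟨c₂, hc₂, h₂⟩ := exists_sq_le_stageCost hQ hR hAJ
  have hQ' := posSemidef_of_eq_transpose_mul hQ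
  -- This constant undoes the discount on the first `q` stage costs.
  set k : ℝ := ∑ t ∈ Finset.range q, (D.β ^ t)⁻¹ with hk
  have hk0 : 0 ≤ k := Finset.sum_nonneg fun t _ => by positivity
  set N : ℝ≥0∞ := ∫⁻ ω, ∑ t ∈ Finset.range q, ENNReal.ofReal (w t ω ⬝ᵥ w t ω) ∂μ with hN
  have hNfin : N ≠ ∞ := by
    rw [hN, lintegral_finsetSum' _ fun t _ => ?_]
    · refine ENNReal.sum_ne_top.mpr fun t _ => ?_
      have hi := (integral_quadForm (hw.memLp t) (hw.mean_zero t) (hw.second_moment t) 1 0).1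
      simp only [zero_add, one_mulVec] at hi
      exact (hi.lintegral_lt_top).ne
    · have hm : Measurable fun ω => w t ω ⬝ᵥ w t ω := by
        have hc : Continuous fun v : Fin s → ℝ => v ⬝ᵥ v := by fun_prop
        exact hc.measurable.comp (hw.measurable t)
      exact hm.ennreal_ofReal.aemeasurable
  refine ⟨ENNReal.ofReal (c₁ * c₂ * k), ENNReal.ofReal (c₁ * c₂) * N + ENNReal.ofReal r,
    ENNReal.ofReal_ne_top, ENNReal.add_ne_top.mpr
      ⟨ENNReal.mul_ne_top ENNReal.ofReal_ne_top hNfin, ENNReal.ofReal_ne_top⟩, fun π x => ?_⟩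
  have hpath : ∀ ω, ENNReal.ofReal (x ⬝ᵥ (P *ᵥ x))
      ≤ ENNReal.ofReal (c₁ * c₂ * k) * D.tailCost π (fun j => w j ω) x 0
        + ENNReal.ofReal (c₁ * c₂) * ∑ t ∈ Finset.range q, ENNReal.ofReal (w t ω ⬝ᵥ w t ω) := by
    intro ω
    set v : ℕ → Fin s → ℝ := fun j => w j ω with hv
    set f : ℕ → ℝ := fun t => D.stageCost (D.state π v x t) (D.control π v x t) with hf
    have hf0 : ∀ t, 0 ≤ f t := fun t => stageCost_nonneg hQ' hR _ _
    have hd0 : ∀ t, 0 ≤ D.β ^ t * f t := fun t => mul_nonneg (by positivity) (hf0 t)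
    have hs0 : 0 ≤ ∑ t ∈ Finset.range q, D.β ^ t * f t := Finset.sum_nonneg fun t _ => hd0 t
    have hw0 : 0 ≤ ∑ t ∈ Finset.range q, v t ⬝ᵥ v t :=
      Finset.sum_nonneg fun t _ => dotProduct_self_nonneg' _
    have e1 : ∑ t ∈ Finset.range q, f t ≤ k * ∑ t ∈ Finset.range q, D.β ^ t * f t := by
      rw [hk, Finset.sum_mul]
      refine Finset.sum_le_sum fun t ht => ?_
      have := Finset.single_le_sum (fun t _ => hd0 t) ht
      have hb : 0 < D.β ^ t := pow_pos hβ0 t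
      rw [← div_eq_inv_mul, le_div_iff₀ hb, mul_comm]
      exact this
    have e2 : x ⬝ᵥ (P *ᵥ x) ≤ c₁ * c₂ * k * ∑ t ∈ Finset.range q, D.β ^ t * f t
        + c₁ * c₂ * ∑ t ∈ Finset.range q, v t ⬝ᵥ v t := by
      have h3 := h₂ (D.control π v x) v x
      simp only [← state_eq_openLoop, Finset.sum_add_distrib] at h3
      calc x ⬝ᵥ (P *ᵥ x) ≤ c₁ * (x ⬝ᵥ x) := h₁ x
        _ ≤ c₁ * (c₂ * (k * ∑ t ∈ Finset.range q, D.β ^ t * f t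
              + ∑ t ∈ Finset.range q, v t ⬝ᵥ v t)) := by
            refine mul_le_mul_of_nonneg_left (h3.trans ?_) hc₁
            exact mul_le_mul_of_nonneg_left (add_le_add_left e1 _) hc₂
        _ = _ := by ring
    refine (ENNReal.ofReal_le_ofReal e2).trans ?_
    rw [ENNReal.ofReal_add (by positivity) (by positivity),
      ENNReal.ofReal_mul (p := c₁ * c₂ * k) (by positivity),
      ENNReal.ofReal_mul (p := c₁ * c₂) (q := ∑ t ∈ Finset.range q, v t ⬝ᵥ v t) (by positivity),
      ENNReal.ofReal_sum_of_nonneg fun t _ => hd0 t,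
      ENNReal.ofReal_sum_of_nonneg fun t _ => dotProduct_self_nonneg' _]
    gcongr
    simp only [tailCost, zero_add]
    exact ENNReal.sum_le_tsum (f := fun t => D.stageTerm π v x t) _
  refine ENNReal.ofReal_add_le.trans ?_
  rw [← add_assoc]
  refine add_le_add ?_ le_rfl
  have hm : Measurable fun ω => D.tailCost π (fun j => w j ω) x 0 :=
    measurable_path_apply hw (f := fun v y => D.tailCost π v y 0) (D.measurable_tailCost π 0) x
  rw [hN, ← lintegral_const_mul' _ _ ENNReal.ofReal_ne_top,
    ← lintegral_const_mul' _ _ ENNReal.ofReal_ne_top, ← lintegral_add_left (hm.const_mul _)]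
  calc ENNReal.ofReal (x ⬝ᵥ (P *ᵥ x)) = ∫⁻ _, ENNReal.ofReal (x ⬝ᵥ (P *ᵥ x)) ∂μ := by simp
    _ ≤ _ := lintegral_mono hpath

omit [IsProbabilityMeasure μ] in
include hw in
theorem tendsto_tailCost (π : Strategy q p) (x : Fin q → ℝ) (h : D.cost μ w π x ≠ ∞) :
    Filter.Tendsto (fun n => ∫⁻ ω, D.tailCost π (fun j => w j ω) x n ∂μ) Filter.atTop
      (nhds 0) := by
  have hm : ∀ t, Measurable fun ω => D.stageTerm π (fun j => w j ω) x t := fun t =>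
    measurable_path_apply hw (f := fun v y => D.stageTerm π v y t) (D.measurable_stageTerm π t) x
  have h1 : ∑' t, ∫⁻ ω, D.stageTerm π (fun j => w j ω) x t ∂μ ≠ ∞ := by
    rw [← lintegral_tsum fun t => (hm t).aemeasurable]
    refine ne_top_of_le_ne_top h ?_
    rw [cost_eq]
    exact lintegral_mono fun ω => le_self_add
  refine (ENNReal.tendsto_sum_nat_add _ h1).congr fun n => ?_
  rw [← lintegral_tsum fun t => (hm (t + n)).aemeasurable]
  refine lintegral_congr fun ω => ?_
  rw [tailCost]
  exact tsum_congr fun t => by rw [add_comm]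

include hw hQ hR hβ0 hβ1 hO hAJ hP hric in
/-- No strategy costs less than the solution of the fixed-point equation. -/
theorem le_cost {r : ℝ} (hr : 0 ≤ r) (hfix : D.FixedPoint S P r) (π : Strategy q p)
    (x : Fin q → ℝ) : ENNReal.ofReal (x ⬝ᵥ (P *ᵥ x) + r) ≤ D.cost μ w π x := by
  obtain ⟨a, b, ha, hb, hab⟩ := exists_quadForm_le_tailCost hw hQ hR hβ0 hAJ P r
  have hM := gainDen_posDef hR hβ0.le hP
  set H : ℕ → (Fin q → ℝ) → ℝ≥0∞ := fun n y => ∫⁻ ω, D.tailCost π (fun j => w j ω) y n ∂μ with hH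
  have hHm : ∀ n, Measurable (H n) := fun n =>
    measurable_lintegral_path hw (f := fun v y => D.tailCost π v y n) (D.measurable_tailCost π n)
  have hfm : ∀ y, Measurable fun ω => D.firstMeas π (fun j => w j ω) y := fun y =>
    (measurable_openLoop (fun t => π.ctrl t y) y (π.wait y)).comp hw.measurable_path
  have hβle : ENNReal.ofReal D.β ≤ 1 := ENNReal.ofReal_le_one.mpr hβ1.le
  -- The error after `n` periods: observability is spent at `n = 0`, and each period moves the tail
  -- at least one step on and gains a factor `β`.
  have key : ∀ n y, ENNReal.ofReal (y ⬝ᵥ (P *ᵥ y) + r)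
      ≤ D.cost μ w π y + a * H n y + b * ENNReal.ofReal D.β ^ n := by
    intro n
    induction n with
    | zero =>
      intro y
      rw [pow_zero, mul_one, add_assoc]
      exact (hab π y).trans le_add_self
    | succ n ih =>
      intro y
      -- The candidate is a subsolution for every strategy: the squares are nonnegative and the
      -- bracket is at least `r`.
      have hstep : ENNReal.ofReal (y ⬝ᵥ (P *ᵥ y) + r)
          ≤ D.periodOp π μ w (fun y => ENNReal.ofReal (y ⬝ᵥ (P *ᵥ y) + r)) y := by
        rw [periodOp_quadForm hw hQ hR hβ0 hO hP hric π y hr]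
        refine ENNReal.ofReal_le_ofReal (add_le_add ?_ (hfix.1 ⟨_, π.one_le_wait y, rfl⟩))
        rw [le_add_iff_nonneg_right]
        exact Finset.sum_nonneg fun t _ => mul_nonneg (by positivity)
          ((posSemidef_real_iff.mp hM.posSemidef).2 _)
      refine (hstep.trans (D.periodOp_mono π μ w ih y)).trans ?_
      set B := ENNReal.ofReal (D.β ^ π.wait y) with hB
      have hBle : B ≤ ENNReal.ofReal D.β := ENNReal.ofReal_le_ofReal
        ((pow_le_pow_of_le_one hβ0.le hβ1.le (π.one_le_wait y)).trans_eq (pow_one _))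
      have hsplit : D.periodOp π μ w
            (fun y => D.cost μ w π y + a * H n y + b * ENNReal.ofReal D.β ^ n) y
          = D.periodOp π μ w (D.cost μ w π) y
            + a * (B * ∫⁻ ω, H n (D.firstMeas π (fun j => w j ω) y) ∂μ)
            + B * (b * ENNReal.ofReal D.β ^ n) := by
        have h1 : ∀ ω, D.firstCost π (fun j => w j ω) y
              + B * (D.cost μ w π (D.firstMeas π (fun j => w j ω) y)
                + a * H n (D.firstMeas π (fun j => w j ω) y) + b * ENNReal.ofReal D.β ^ n)
            = (D.firstCost π (fun j => w j ω) y
                + B * D.cost μ w π (D.firstMeas π (fun j => w j ω) y))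
              + a * (B * H n (D.firstMeas π (fun j => w j ω) y))
              + B * (b * ENNReal.ofReal D.β ^ n) := fun ω => by ring
        have hm : Measurable fun ω => a * (B * H n (D.firstMeas π (fun j => w j ω) y)) :=
          (((hHm n).comp (hfm y)).const_mul B).const_mul a
        rw [periodOp, lintegral_congr h1, lintegral_add_right _ measurable_const,
          lintegral_add_right _ hm, lintegral_const_mul' _ _ ha,
          lintegral_const_mul' _ _ ENNReal.ofReal_ne_top, periodOp, lintegral_const, measure_univ,
          mul_one]
      rw [hsplit, ← cost_eq_periodOp π hw hβ0.le y]
      refine add_le_add (add_le_add le_rfl ?_) ?_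
      · gcongr
        exact lintegral_tailCost_firstMeas_le π hw hβ0.le n y
      · rw [pow_succ', mul_left_comm]
        gcongr
  by_cases hfin : D.cost μ w π x = ∞
  · rw [hfin]; exact le_top
  have hlim : Filter.Tendsto (fun n => D.cost μ w π x + a * H n x + b * ENNReal.ofReal D.β ^ n)
      Filter.atTop (nhds (D.cost μ w π x + a * 0 + b * 0)) := by
    refine (tendsto_const_nhds.add (ENNReal.Tendsto.const_mul (tendsto_tailCost hw π x hfin)
      (Or.inr ha))).add (ENNReal.Tendsto.const_mul ?_ (Or.inr hb))
    exact ENNReal.tendsto_pow_atTop_nhds_zero_of_lt_one (ENNReal.ofReal_lt_one.mpr hβ1)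
  simp only [mul_zero, add_zero] at hlim
  exact ge_of_tendsto' hlim fun n => key n x

/-- The strategy with constant waiting time and the optimal feedback on the estimated state. -/
noncomputable def periodicStrategy (D : LQGData q p s) (P : Matrix (Fin q) (Fin q) ℝ) {T : ℕ}
    (hT : 1 ≤ T) : Strategy q p where
  wait _ := T
  ctrl := D.feedback P
  one_le_wait _ := hT
  measurable_wait := measurable_const
  measurable_ctrl k := by
    refine Continuous.measurable ?_
    exact (continuous_const.matrix_mulVec (continuous_const.matrix_mulVec continuous_id)).neg

include hw hQ hR hβ0 hβ1 hO hP hric in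
theorem cost_periodicStrategy_le {T : ℕ} (hT : 1 ≤ T) (x : Fin q → ℝ) :
    D.cost μ w (D.periodicStrategy P hT) x
      ≤ ENNReal.ofReal (x ⬝ᵥ (P *ᵥ x) + D.periodicOffset S P T) := by
  refine cost_le_of_periodOp_le (D.periodicStrategy P hT) hw hβ0.le
    (f := fun y => ENNReal.ofReal (y ⬝ᵥ (P *ᵥ y) + D.periodicOffset S P T)) (fun y => ?_) x
  rw [periodOp_quadForm hw hQ hR hβ0 hO hP hric _ y
    (periodicOffset_nonneg hw hR hβ0 hβ1 hO hP hT)]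
  simp only [periodicStrategy, feedback_add_gain, zero_dotProduct, mul_zero,
    Finset.sum_const_zero, add_zero, bracket_periodicOffset hβ0.le hβ1 S P hT, le_refl]

include hw hQ hR hβ0 hβ1 hO hAJ hP hric in
theorem value_eq {r : ℝ} (hr : 0 ≤ r) (hfix : D.FixedPoint S P r) (x : Fin q → ℝ) :
    D.value μ w x = ENNReal.ofReal (x ⬝ᵥ (P *ᵥ x) + r) := by
  have hx := (posSemidef_real_iff.mp hP).2 x
  have hub : ∀ T, 1 ≤ T → D.value μ w x
      ≤ ENNReal.ofReal (x ⬝ᵥ (P *ᵥ x) + D.periodicOffset S P T) := fun T hT =>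
    (iInf_le _ (D.periodicStrategy P hT)).trans
      (cost_periodicStrategy_le hw hQ hR hβ0 hβ1 hO hP hric hT x)
  refine le_antisymm ?_ (le_iInf fun π => le_cost hw hQ hR hβ0 hβ1 hO hAJ hP hric hr hfix π x)
  have hfin : D.value μ w x ≠ ∞ := ne_top_of_le_ne_top ENNReal.ofReal_ne_top (hub 1 le_rfl)
  rw [ENNReal.le_ofReal_iff_toReal_le hfin (add_nonneg hx hr), ← sub_le_iff_le_add']
  -- `V(x) - x'Px` lies below every periodic offset, hence below their infimum `r`. No optimal `T`
  -- has to exist.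
  refine ((fixedPoint_iff hβ0 hβ1 S P r).mp hfix).2 ?_
  rintro _ ⟨T, hT, rfl⟩
  have h0 := periodicOffset_nonneg hw hR hβ0 hβ1 hO hP hT
  have h := hub T hT
  rw [ENNReal.le_ofReal_iff_toReal_le hfin (add_nonneg hx h0)] at h
  linarith

include hw hQ hR hβ0 hβ1 hO hAJ hP hric in
theorem lookahead_eq {r : ℝ} (hr : 0 ≤ r) (hfix : D.FixedPoint S P r) (x : Fin q → ℝ) (T : ℕ) :
    D.lookahead μ w x T = ENNReal.ofReal (x ⬝ᵥ (P *ᵥ x) + D.bracket S P r T) := by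
  have hM := gainDen_posDef hR hβ0.le hP
  rw [lookahead]
  simp only [value_eq hw hQ hR hβ0 hβ1 hO hAJ hP hric hr hfix,
    lintegral_period hw (posSemidef_of_eq_transpose_mul hQ) hR hβ0.le hO hP hric _ x T hr]
  refine le_antisymm ((iInf_le _ fun t => D.feedback P t x).trans_eq ?_) (le_iInf fun u => ?_)
  · simp [feedback_add_gain]
  · refine ENNReal.ofReal_le_ofReal (add_le_add ?_ le_rfl)
    rw [le_add_iff_nonneg_right]
    exact Finset.sum_nonneg fun t _ => mul_nonneg (by positivity)
      ((posSemidef_real_iff.mp hM.posSemidef).2 _)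

include hw hQ hR hβ0 hβ1 hO hAJ hP hric in
-- The lookahead cost is `x'Px` plus the bracket, so the state drops out of the comparison. A
-- minimal bracket is a lower bound of all brackets and therefore equals their infimum `r`.
theorem isOptimalWait_iff {r : ℝ} (hr : 0 ≤ r) (hfix : D.FixedPoint S P r) (x : Fin q → ℝ)
    (T : ℕ) : D.IsOptimalWait μ w x T ↔ 1 ≤ T ∧ D.bracket S P r T = r := by
  have hx := (posSemidef_real_iff.mp hP).2 x
  have hge : ∀ T, 1 ≤ T → r ≤ D.bracket S P r T := fun T hT => hfix.1 ⟨T, hT, rfl⟩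
  simp only [IsOptimalWait, lookahead_eq hw hQ hR hβ0 hβ1 hO hAJ hP hric hr hfix]
  refine and_congr_right fun hT => ⟨fun h => ?_, fun h T' hT' => ?_⟩
  · refine le_antisymm (hfix.2 ?_) (hge T hT)
    rintro _ ⟨T', hT', rfl⟩
    have h1 := h T' hT'
    rw [ENNReal.ofReal_le_ofReal_iff (add_nonneg hx (hr.trans (hge T' hT')))] at h1
    linarith
  · rw [h]
    exact ENNReal.ofReal_le_ofReal (add_le_add le_rfl (hge T' hT'))

end Value

end LQGData

theorem mainTheorem3 {q p s m : ℕ} (D : LQGData q p s) (J : Matrix (Fin m) (Fin q) ℝ)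
    (S : Matrix (Fin s) (Fin s) ℝ)
    {Ω : Type*} [MeasurableSpace Ω] (μ : Measure Ω) [IsProbabilityMeasure μ]
    (w : ℕ → Ω → Fin s → ℝ) (hw : IsGaussianWhiteNoise w S μ)
    (hQ : D.Q = Jᵀ * J) (hR : D.R.PosDef)
    (hβ0 : 0 < D.β) (hβ1 : D.β < 1) (hO : 0 ≤ D.O)
    (hAB : IsControllable D.A D.B) (hAJ : IsObservable D.A J) :
    -- the matrices `errCov` are the error covariances of the open-loop estimate `E[x_t]`
    (∀ (u : ℕ → Fin p → ℝ) (x : Fin q → ℝ) (t : ℕ) (i j : Fin q),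
      cov[fun ω => D.openLoop u (fun k => w k ω) x t i,
        fun ω => D.openLoop u (fun k => w k ω) x t j; μ] = D.errCov S t i j) ∧
    ∃ P : Matrix (Fin q) (Fin q) ℝ,
      P.PosDef ∧ D.Riccati P ∧
      (∀ P' : Matrix (Fin q) (Fin q) ℝ, P'.PosSemidef → D.Riccati P' → P' = P) ∧
      ∃ r : ℝ,
        D.FixedPoint S P r ∧ (∀ r' : ℝ, D.FixedPoint S P r' → r' = r) ∧
        (∀ x : Fin q → ℝ,
          D.value μ w x ≠ ∞ ∧ (D.value μ w x).toReal = x ⬝ᵥ (P *ᵥ x) + r) ∧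
        -- the optimal waiting times are the minimizers in the fixed-point equation, for every `x`
        (∀ (x : Fin q → ℝ) (T : ℕ),
          D.IsOptimalWait μ w x T ↔ 1 ≤ T ∧ D.bracket S P r T = r) := by
  refine ⟨LQGData.cov_openLoop hw, ?_⟩
  have hQ' := LQGData.posSemidef_of_eq_transpose_mul hQ
  obtain ⟨P, hP, hric⟩ := LQGData.exists_riccati hQ' hR hβ0.le hAB
  refine ⟨P, LQGData.riccati_posDef hQ hR hβ0 hAJ hP hric, hric,
    fun P' hP' hric' => LQGData.riccati_unique hQ hR hβ0 hAJ hP hP' hric hric', ?_⟩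
  -- Nonnegative offsets supply both the existence of the infimum and `0 ≤ r`, which the passage to
  -- `ℝ≥0∞` needs.
  have hnn : 0 ∈ lowerBounds {c : ℝ | ∃ T : ℕ, 1 ≤ T ∧ c = D.periodicOffset S P T} := by
    rintro _ ⟨T, hT, rfl⟩
    exact LQGData.periodicOffset_nonneg hw hR hβ0 hβ1 hO hP hT
  obtain ⟨r, hr⟩ := Real.exists_isGLB
    (s := {c : ℝ | ∃ T : ℕ, 1 ≤ T ∧ c = D.periodicOffset S P T}) ⟨_, 1, le_rfl, rfl⟩ ⟨0, hnn⟩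
  have hr0 : 0 ≤ r := hr.2 hnn
  have hfix : D.FixedPoint S P r := (LQGData.fixedPoint_iff hβ0 hβ1 S P r).mpr hr
  refine ⟨r, hfix, fun r' hr' => ((LQGData.fixedPoint_iff hβ0 hβ1 S P r').mp hr').unique hr,
    fun x => ?_, LQGData.isOptimalWait_iff hw hQ hR hβ0 hβ1 hO hAJ hP hric hr0 hfix⟩
  rw [LQGData.value_eq hw hQ hR hβ0 hβ1 hO hAJ hP hric hr0 hfix]
  exact ⟨ENNReal.ofReal_ne_top, ENNReal.toReal_ofReal
    (add_nonneg ((posSemidef_real_iff.mp hP).2 x) hr0)⟩
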